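/- Conventions. Modules are right modules unless a side is indicated; $\mathrm{mod}\,S$ is the category of finitely generated right $S$-modules. A Noetherian algebra is a ring that is finitely generated as a module over a commutative Noetherian ring (through a ring homomorphism into its centre). For a class $\mathcal U$ of objects of an abelian category, $\mathrm{add}\,\mathcal U$ is the class of direct summands of finite direct sums of objects of $\mathcal U$. Let $\mathscr A$ be an abelian category with enough projectives; $\Omega^n(A)$ denotes an $n$-th syzygy of $A$. The Igusa–Todorov distance $\mathrm{IT}(\mathscr A)\in\mathbb N\cup\{\infty\}$ is the infimum of all $m\ge 0$ for which there are $n\ge 0$ and an object $U$ such that for every object $A$ there is an exact sequence $0\to U_m\to\cdots\to U_0\to\Omega^n(A)\to 0$ with all $U_i\in\mathrm{add}\,U$. Put $[T]_1=\mathrm{add}\,T$ and let $[T]_{n}$ $(n\ge 2)$ be $\mathrm{add}$ of the class of all $A$ admitting a short exact sequence $0\to U\to A\to V\to 0$ with $U\in[T]_1$, $V\in[T]_{n-1}$; the extension dimension $\dim\mathscr A$ is the infimum of all $n\ge 0$ with $\mathscr A=[T]_{n+1}$ for some object $T$. In a triangulated category $\mathscr T$ let $\langle T\rangle_1$ be the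 closure of $T$ under shifts, finite direct sums and direct summands, and $\langle T\rangle_{n+1}$ the closure under the same operations of the class of all $X$ in a triangle $U\to X\to V\to U[1]$ with $U\in\langle T\rangle_1$, $V\in\langle T\rangle_n$; the Rouquier dimension $\mathrm{der.dim}\,\mathscr T$ is the infimum of all $n\ge 0$ with $\mathscr T=\langle T\rangle_{n+1}$ for some object $T$. (Infima of empty sets are $\infty$.) For a right Noetherian ring $S$ write $\mathrm{IT}(S)=\mathrm{IT}(\mathrm{mod}\,S)$ and $\dim S=\dim(\mathrm{mod}\,S)$. Theorem. Let $\Gamma$ be a Noetherian algebra, let $M$ be a $\Gamma$-bimodule that is finitely generated both as a left and as a right $\Gamma$-module, and let $\theta\colon M\otimes_\Gamma M\to M$ be a $\Gamma$-bimodule homomorphism with $\theta(\theta\otimes\mathrm{id}_M)=\theta(\mathrm{id}_M\otimes\theta)$. Let $n\ge 1$ be an integer with $M^{\otimes_\Gamma n}=0$. Let $\Gamma\ltimes_\theta M$ be the ring with underlying group $\Gamma\oplus M$ and multiplication $(\gamma,m)(\gamma',m')=(\gamma\gamma',\gamma m'+m\gamma'+\theta(m\otimes m'))$. 1. If ${}_\Gamma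 M$ and $M_\Gamma$ are projective, then $\mathrm{IT}(\Gamma)\le\mathrm{IT}(\Gamma\ltimes_\theta M)\le n(\mathrm{IT}(\Gamma)+1)-1$. 2. If $M_\Gamma$ is projective, then $\dim\Gamma\le\dim(\Gamma\ltimes_\theta M)\le n(\dim\Gamma+1)-1$. 3. If $M$ is left perfect, that is, the left $\Gamma$-module ${}_\Gamma M$ has finite projective dimension and $\mathrm{Tor}_i^\Gamma(M,M^{\otimes_\Gamma j})=0$ for all $i,j\ge 1$, then $$\mathrm{der.dim}\,\mathbf D^b(\mathrm{mod}\,\Gamma)\le\mathrm{der.dim}\,\mathbf D^b(\mathrm{mod}\,\Gamma\ltimes_\theta M)\le n\bigl(\mathrm{der.dim}\,\mathbf D^b(\mathrm{mod}\,\Gamma)+1\bigr)-1 .$$ -/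

import Mathlib

open CategoryTheory CategoryTheory.Limits MulOpposite
open scoped TensorProduct

universe v u

/-! ## Invariants of abelian and triangulated categories -/

section AbelianInvariants

variable {C : Type u} [Category.{v} C] [Abelian C]

attribute [local instance] Abelian.hasFiniteBiproducts

/-- `add U`: direct summands of finite direct sums of objects in `U`. -/
def addClosure (U : ObjectProperty C) : ObjectProperty C := fun X =>
  ∃ (k : ℕ) (Y : Fin k → C), (∀ i, U (Y i)) ∧ Nonempty (Retract X (⨁ Y))

/-- `IsSyzygy n X K`: the object `K` is an `n`-th syzygy `Ωⁿ(X)` of `X`, where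
`Ω⁰(X) = X` and `Ω¹(Y)` is the kernel of an epimorphism from a projective object onto `Y`. -/
def IsSyzygy : ℕ → C → C → Prop
  | 0, X, K => Nonempty (K ≅ X)
  | n + 1, X, K => ∃ Y : C, IsSyzygy n X Y ∧
      ∃ S : ShortComplex C, S.ShortExact ∧ Projective S.X₂ ∧
        Nonempty (S.X₁ ≅ K) ∧ Nonempty (S.X₃ ≅ Y)

/-- There is an exact sequence `0 → X m → ⋯ → X 1 → X 0 → K → 0` in which every `X i`
belongs to `V` (it is recorded as an infinite sequence with `X i = 0` for `i > m`). -/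
def HasResolution (V : ObjectProperty C) (m : ℕ) (K : C) : Prop :=
  ∃ (X : ℕ → C) (d : ∀ i, X (i + 1) ⟶ X i) (ε : X 0 ⟶ K)
    (w₀ : d 0 ≫ ε = 0) (w : ∀ i, d (i + 1) ≫ d i = 0),
    (∀ i ≤ m, V (X i)) ∧ (∀ i, m < i → IsZero (X i)) ∧
    Epi ε ∧ (ShortComplex.mk (d 0) ε w₀).Exact ∧
    ∀ i, (ShortComplex.mk (d (i + 1)) (d i) (w i)).Exact

variable (C)

/-- `(m, n)`-Igusa–Todorov categories. -/
def IsIgusaTodorovCategory (m n : ℕ) : Prop :=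
  ∃ U : C, ∀ A : C, ∃ K : C, IsSyzygy n A K ∧
    HasResolution (addClosure (ObjectProperty.singleton U)) m K

/-- The Igusa–Todorov distance (`⊤` if there is no `m`). -/
noncomputable def igusaTodorovDistance : ℕ∞ :=
  ⨅ (m : ℕ) (_ : ∃ n : ℕ, IsIgusaTodorovCategory C m n), (m : ℕ∞)

variable {C}

/-- `U ∙ V`: the additive closure of the class of all extensions `0 → U₁ → A → V₁ → 0`
with `U₁` in `U` and `V₁` in `V`. -/
def extensionBullet (U V : ObjectProperty C) : ObjectProperty C :=
  addClosure fun A => ∃ S : ShortComplex C, S.ShortExact ∧ U S.X₁ ∧ V S.X₃ ∧ S.X₂ = A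

/-- `[U]₀ = 0`, `[U]₁ = add U` and `[U]ₙ = [U]₁ ∙ [U]ₙ₋₁` for `n ≥ 2`. -/
def extensionLevel (U : ObjectProperty C) : ℕ → ObjectProperty C
  | 0 => fun X => IsZero X
  | 1 => addClosure U
  | n + 2 => extensionBullet (addClosure U) (extensionLevel U (n + 1))

variable (C)

/-- The extension dimension of an abelian category (`⊤` if there is no `n`). -/
noncomputable def extensionDimension : ℕ∞ :=
  ⨅ (n : ℕ) (_ : ∃ T : C, ∀ X : C, extensionLevel (ObjectProperty.singleton T) (n + 1) X),
    (n : ℕ∞)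

end AbelianInvariants

/-- The Rouquier dimension of a triangulated category (`⊤` if there is no `n`).
`triangEnvelopeIter n` is `⟨T⟩ₙ₊₁`: shifts, finite sums and summands of `T`, and `n` extensions. -/
noncomputable def rouquierDimension (T : Type u) [Category.{v} T] [HasZeroObject T]
    [HasShift T ℤ] [Preadditive T] [∀ n : ℤ, (shiftFunctor T n).Additive]
    [Pretriangulated T] : ℕ∞ :=
  ⨅ (n : ℕ) (_ : ∃ G : T, (ObjectProperty.singleton G).triangEnvelopeIter n = ⊤), (n : ℕ∞)

/-! ## Noetherian algebras and their categories of finitely generated right modules -/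

/-- A Noetherian algebra: a ring that is module-finite over a commutative Noetherian ring. -/
class IsNoetherianAlgebra (Γ : Type u) [Ring Γ] : Prop where
  out : ∃ (R : Type u) (_ : CommRing R) (_ : Algebra R Γ), IsNoetherianRing R ∧ Module.Finite R Γ

instance IsNoetherianAlgebra.isNoetherianRing_op (Γ : Type u) [Ring Γ] [h : IsNoetherianAlgebra Γ] :
    IsNoetherianRing Γᵐᵒᵖ := by
  obtain ⟨R, _, _, _, _⟩ := h.out
  have : Module.Finite R Γᵐᵒᵖ := Module.Finite.equiv (opLinearEquiv R : Γ ≃ₗ[R] Γᵐᵒᵖ)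
  have : IsNoetherian R Γᵐᵒᵖ := inferInstance
  exact isNoetherian_of_tower R this

section RingInvariants

variable (Γ : Type u) [Ring Γ]

/-- `mod-Γ`: finitely generated right `Γ`-modules, i.e. left modules over `Γᵐᵒᵖ`. -/
abbrev FGRightMod : Type (u + 1) := FGModuleCat.{u} Γᵐᵒᵖ

variable [IsNoetherianRing Γᵐᵒᵖ]

/-- `IT(Γ)`, the Igusa–Todorov distance of `mod-Γ`. -/
noncomputable def ringIT : ℕ∞ := igusaTodorovDistance (FGRightMod Γ)

/-- `dim Γ`, the extension dimension of `mod-Γ`. -/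
noncomputable def ringExtDim : ℕ∞ := extensionDimension (FGRightMod Γ)

/-- The Rouquier dimension of the bounded derived category of `mod-Γ`. -/
noncomputable def ringDerDim : ℕ∞ :=
  letI := HasDerivedCategory.standard (FGRightMod Γ)
  rouquierDimension (DerivedCategory.Bounded (FGRightMod Γ))

end RingInvariants

/-! ## Tensor products over a noncommutative ring -/

section BalancedTensor

variable (Γ : Type u) [Ring Γ]

/-- The relations `mγ ⊗ n = m ⊗ γn`. -/
def balancedRelations (M N : Type u) [AddCommGroup M] [Module Γᵐᵒᵖ M]
    [AddCommGroup N] [Module Γ N] : AddSubgroup (M ⊗[ℤ] N) :=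
  AddSubgroup.closure {x | ∃ (m : M) (γ : Γ) (n : N), x = (op γ • m) ⊗ₜ[ℤ] n - m ⊗ₜ[ℤ] (γ • n)}

/-- `M ⊗_Γ N` for a right `Γ`-module `M` and a left `Γ`-module `N`. -/
def BalancedTensor (M N : Type u) [AddCommGroup M] [Module Γᵐᵒᵖ M]
    [AddCommGroup N] [Module Γ N] : Type u :=
  (M ⊗[ℤ] N) ⧸ balancedRelations Γ M N

namespace BalancedTensor

section Basic

variable {M N : Type u} [AddCommGroup M] [Module Γᵐᵒᵖ M] [AddCommGroup N] [Module Γ N]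

instance : AddCommGroup (BalancedTensor Γ M N) :=
  inferInstanceAs (AddCommGroup ((M ⊗[ℤ] N) ⧸ balancedRelations Γ M N))

/-- The pure tensor `m ⊗ n`. -/
def tmul (m : M) (n : N) : BalancedTensor Γ M N := QuotientAddGroup.mk' (balancedRelations Γ M N) (m ⊗ₜ[ℤ] n)

lemma add_tmul (m m' : M) (n : N) : tmul Γ (m + m') n = tmul Γ m n + tmul Γ m' n := by
  simp only [tmul, TensorProduct.add_tmul, map_add]; rfl

lemma tmul_add (m : M) (n n' : N) : tmul Γ m (n + n') = tmul Γ m n + tmul Γ m n' := by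
  simp only [tmul, TensorProduct.tmul_add, map_add]; rfl

lemma zero_tmul (n : N) : tmul Γ (0 : M) n = 0 := by
  simp only [tmul, TensorProduct.zero_tmul, map_zero]; rfl

lemma tmul_zero (m : M) : tmul Γ m (0 : N) = 0 := by
  simp only [tmul, TensorProduct.tmul_zero, map_zero]; rfl

lemma smul_tmul (m : M) (γ : Γ) (n : N) : tmul Γ (op γ • m) n = tmul Γ m (γ • n) := by
  refine QuotientAddGroup.eq_iff_sub_mem.mpr (AddSubgroup.subset_closure ⟨m, γ, n, rfl⟩)

variable {Γ} in
@[elab_as_elim]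
lemma induction_on {p : BalancedTensor Γ M N → Prop} (x : BalancedTensor Γ M N)
    (zero : p 0) (tmul : ∀ m n, p (tmul Γ m n)) (add : ∀ x y, p x → p y → p (x + y)) : p x := by
  obtain ⟨t, rfl⟩ := QuotientAddGroup.mk'_surjective (balancedRelations Γ M N) x
  induction t using TensorProduct.induction_on with
  | zero => rw [map_zero]; exact zero
  | tmul m n => exact tmul m n
  | add a b ha hb => rw [map_add]; exact add _ _ ha hb

variable {M' N' : Type u} [AddCommGroup M'] [Module Γᵐᵒᵖ M'] [AddCommGroup N'] [Module Γ N']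

/-- `f ⊗ g` for a right-linear map `f` and a left-linear map `g`. -/
def map (f : M →ₗ[Γᵐᵒᵖ] M') (g : N →ₗ[Γ] N') : BalancedTensor Γ M N →+ BalancedTensor Γ M' N' :=
  QuotientAddGroup.map (balancedRelations Γ M N) (balancedRelations Γ M' N')
    (TensorProduct.map f.toAddMonoidHom.toIntLinearMap
      g.toAddMonoidHom.toIntLinearMap).toAddMonoidHom (by
      rw [balancedRelations, AddSubgroup.closure_le]
      rintro _ ⟨m, γ, n, rfl⟩
      refine AddSubgroup.subset_closure ⟨f m, γ, g n, ?_⟩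
      rw [map_sub]
      exact congrArg₂ (fun a b => a ⊗ₜ[ℤ] g n - f m ⊗ₜ[ℤ] b) (f.map_smul _ _) (g.map_smul _ _))

@[simp]
lemma map_tmul (f : M →ₗ[Γᵐᵒᵖ] M') (g : N →ₗ[Γ] N') (m : M) (n : N) :
    map Γ f g (tmul Γ m n) = tmul Γ (f m) (g n) := rfl

end Basic

section LeftModule

variable {M N : Type u} [AddCommGroup M] [Module Γ M] [Module Γᵐᵒᵖ M] [SMulCommClass Γ Γᵐᵒᵖ M]
  [AddCommGroup N] [Module Γ N]

/-- The left action `γ(m ⊗ n) = γm ⊗ n`. -/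
instance : SMul Γ (BalancedTensor Γ M N) where
  smul γ := map Γ (Module.toModuleEnd Γᵐᵒᵖ (S := Γ) M γ) LinearMap.id

lemma smul_tmul_left (γ : Γ) (m : M) (n : N) : γ • tmul Γ m n = tmul Γ (γ • m) n := rfl

instance : DistribSMul Γ (BalancedTensor Γ M N) where
  smul_zero γ := map_zero (map Γ (Module.toModuleEnd Γᵐᵒᵖ (S := Γ) M γ) LinearMap.id)
  smul_add γ := map_add (map Γ (Module.toModuleEnd Γᵐᵒᵖ (S := Γ) M γ) LinearMap.id)

instance : Module Γ (BalancedTensor Γ M N) where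
  smul_zero := smul_zero
  smul_add := smul_add
  one_smul x := by
    induction x using induction_on with
    | zero => exact smul_zero _
    | tmul m n => rw [smul_tmul_left, one_smul]
    | add x y hx hy => rw [smul_add, hx, hy]
  mul_smul a b x := by
    induction x using induction_on with
    | zero => simp only [smul_zero]
    | tmul m n => simp only [smul_tmul_left, mul_smul]
    | add x y hx hy => simp only [smul_add, hx, hy]
  add_smul a b x := by
    induction x using induction_on with
    | zero => simp only [smul_zero, add_zero]
    | tmul m n => simp only [smul_tmul_left, add_smul, add_tmul]
    | add x y hx hy => simp only [smul_add, hx, hy]; abel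
  zero_smul x := by
    induction x using induction_on with
    | zero => exact smul_zero _
    | tmul m n => rw [smul_tmul_left, zero_smul, zero_tmul]
    | add x y hx hy => rw [smul_add, hx, hy, add_zero]

end LeftModule

section RightModule

variable {M N : Type u} [AddCommGroup M] [Module Γᵐᵒᵖ M]
  [AddCommGroup N] [Module Γ N] [Module Γᵐᵒᵖ N] [SMulCommClass Γ Γᵐᵒᵖ N]

/-- The right action `(m ⊗ n)γ = m ⊗ nγ`. -/
instance : SMul Γᵐᵒᵖ (BalancedTensor Γ M N) where
  smul γ :=
    haveI := SMulCommClass.symm Γ Γᵐᵒᵖ N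
    map Γ LinearMap.id (Module.toModuleEnd Γ (S := Γᵐᵒᵖ) N γ)

lemma smul_tmul_right (γ : Γᵐᵒᵖ) (m : M) (n : N) : γ • tmul Γ m n = tmul Γ m (γ • n) := rfl

instance : DistribSMul Γᵐᵒᵖ (BalancedTensor Γ M N) where
  smul_zero γ :=
    haveI := SMulCommClass.symm Γ Γᵐᵒᵖ N
    map_zero (map Γ (LinearMap.id (M := M)) (Module.toModuleEnd Γ (S := Γᵐᵒᵖ) N γ))
  smul_add γ :=
    haveI := SMulCommClass.symm Γ Γᵐᵒᵖ N
    map_add (map Γ (LinearMap.id (M := M)) (Module.toModuleEnd Γ (S := Γᵐᵒᵖ) N γ))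

instance : Module Γᵐᵒᵖ (BalancedTensor Γ M N) where
  smul_zero := smul_zero
  smul_add := smul_add
  one_smul x := by
    induction x using induction_on with
    | zero => exact smul_zero _
    | tmul m n => rw [smul_tmul_right, one_smul]
    | add x y hx hy => rw [smul_add, hx, hy]
  mul_smul a b x := by
    induction x using induction_on with
    | zero => simp only [smul_zero]
    | tmul m n => simp only [smul_tmul_right, mul_smul]
    | add x y hx hy => simp only [smul_add, hx, hy]
  add_smul a b x := by
    induction x using induction_on with
    | zero => simp only [smul_zero, add_zero]
    | tmul m n => simp only [smul_tmul_right, add_smul, tmul_add]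
    | add x y hx hy => simp only [smul_add, hx, hy]; abel
  zero_smul x := by
    induction x using induction_on with
    | zero => exact smul_zero _
    | tmul m n => rw [smul_tmul_right, zero_smul, tmul_zero]
    | add x y hx hy => rw [smul_add, hx, hy, add_zero]

end RightModule

instance {M N : Type u} [AddCommGroup M] [Module Γ M] [Module Γᵐᵒᵖ M] [SMulCommClass Γ Γᵐᵒᵖ M]
    [AddCommGroup N] [Module Γ N] [Module Γᵐᵒᵖ N] [SMulCommClass Γ Γᵐᵒᵖ N] :
    SMulCommClass Γ Γᵐᵒᵖ (BalancedTensor Γ M N) where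
  smul_comm a b x := by
    induction x using induction_on with
    | zero => simp only [smul_zero]
    | tmul m n => simp only [smul_tmul_right, smul_tmul_left]
    | add x y hx hy => simp only [smul_add, hx, hy]

end BalancedTensor

/-- A bundled `Γ`-bimodule. -/
structure BimoduleObj : Type (u + 1) where
  carrier : Type u
  [addCommGroup : AddCommGroup carrier]
  [left : Module Γ carrier]
  [right : Module Γᵐᵒᵖ carrier]
  [comm : SMulCommClass Γ Γᵐᵒᵖ carrier]

attribute [instance] BimoduleObj.addCommGroup BimoduleObj.left BimoduleObj.right BimoduleObj.comm

section Powers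

variable (M : Type u) [AddCommGroup M] [Module Γ M] [Module Γᵐᵒᵖ M] [SMulCommClass Γ Γᵐᵒᵖ M]

/-- The bimodule `M^{⊗ n}`: `Γ`, `M`, `M ⊗_Γ M`, `M ⊗_Γ (M ⊗_Γ M)`, … -/
def tensorPowerObj : ℕ → BimoduleObj Γ
  | 0 => ⟨Γ⟩
  | 1 => ⟨M⟩
  | n + 2 => ⟨BalancedTensor Γ M (tensorPowerObj (n + 1)).carrier⟩

/-- The underlying group of `M^{⊗ n}`. -/
abbrev BimodulePower (n : ℕ) : Type u := (tensorPowerObj Γ M n).carrier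

end Powers

/-! ### Tor and left perfect bimodules -/

section Tor

variable (M : Type u) [AddCommGroup M] [Module Γᵐᵒᵖ M]

/-- The functor `M ⊗_Γ -` from left `Γ`-modules to abelian groups. -/
def balancedTensorFunctor : ModuleCat.{u} Γ ⥤ AddCommGrpCat.{u} where
  obj N := AddCommGrpCat.of (BalancedTensor Γ M N)
  map f := AddCommGrpCat.ofHom (BalancedTensor.map Γ LinearMap.id f.hom)
  map_id N := by
    ext x
    induction x using BalancedTensor.induction_on with
    | zero => simp
    | tmul m n => rfl
    | add x y hx hy => simp only [map_add, hx, hy]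
  map_comp f g := by
    ext x
    induction x using BalancedTensor.induction_on with
    | zero => simp
    | tmul m n => rfl
    | add x y hx hy => simp only [map_add, hx, hy]

instance : (balancedTensorFunctor Γ M).Additive where
  map_add {N N' f g} := by
    ext x
    change BalancedTensor.map Γ LinearMap.id (f + g).hom x =
      BalancedTensor.map Γ LinearMap.id f.hom x + BalancedTensor.map Γ LinearMap.id g.hom x
    induction x using BalancedTensor.induction_on with
    | zero => simp
    | tmul m n => exact BalancedTensor.tmul_add Γ m (f.hom n) (g.hom n)
    | add x y hx hy => simp only [map_add, hx, hy]; abel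

/-- `Tor_i^Γ(M, N)` for a right module `M` and a left module `N`. -/
noncomputable def balancedTor (i : ℕ) (N : Type u) [AddCommGroup N] [Module Γ N] :
    AddCommGrpCat.{u} :=
  ((balancedTensorFunctor Γ M).leftDerived i).obj (ModuleCat.of Γ N)

end Tor

/-- A bimodule `M` is left perfect if `pd (_Γ M) < ∞` and `Tor_i^Γ(M, M^{⊗ j}) = 0` for all
`i, j ≥ 1`. -/
structure IsLeftPerfect (M : Type u) [AddCommGroup M] [Module Γ M] [Module Γᵐᵒᵖ M]
    [SMulCommClass Γ Γᵐᵒᵖ M] : Prop where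
  projectiveDimension_lt_top : ∃ d : ℕ, HasProjectiveDimensionLE (ModuleCat.of Γ M) d
  tor_eq_zero : ∀ i j : ℕ, 1 ≤ i → 1 ≤ j → IsZero (balancedTor Γ M i (BimodulePower Γ M j))

end BalancedTensor

/-! ## The `θ`-extension ring -/

/-- An associative `Γ`-bimodule homomorphism `θ : M ⊗_Γ M → M`. -/
structure AssocBimoduleHom (Γ : Type u) [Ring Γ] (M : Type u) [AddCommGroup M] [Module Γ M]
    [Module Γᵐᵒᵖ M] [SMulCommClass Γ Γᵐᵒᵖ M] where
  toHom : BalancedTensor Γ M M →+ M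
  map_smul_left : ∀ (γ : Γ) (x : BalancedTensor Γ M M), toHom (γ • x) = γ • toHom x
  map_smul_right : ∀ (γ : Γᵐᵒᵖ) (x : BalancedTensor Γ M M), toHom (γ • x) = γ • toHom x
  assoc : ∀ m m' m'' : M,
    toHom (BalancedTensor.tmul Γ (toHom (BalancedTensor.tmul Γ m m')) m'') =
      toHom (BalancedTensor.tmul Γ m (toHom (BalancedTensor.tmul Γ m' m'')))

section ThetaExtension

variable {Γ : Type u} [Ring Γ] {M : Type u} [AddCommGroup M] [Module Γ M]
  [Module Γᵐᵒᵖ M] [SMulCommClass Γ Γᵐᵒᵖ M]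

/-- The `θ`-extension `Γ ⋉_θ M`, with underlying group `Γ ⊕ M`. -/
def ThetaExtension (_θ : AssocBimoduleHom Γ M) : Type u := Γ × M

namespace ThetaExtension

variable {θ : AssocBimoduleHom Γ M}

instance : AddCommGroup (ThetaExtension θ) := inferInstanceAs (AddCommGroup (Γ × M))

/-- `(γ, m)(γ', m') = (γγ', γm' + mγ' + θ(m ⊗ m'))`. -/
instance : Mul (ThetaExtension θ) where
  mul x y := (x.1 * y.1, x.1 • y.2 + op y.1 • x.2 + θ.toHom (BalancedTensor.tmul Γ x.2 y.2))

instance : One (ThetaExtension θ) where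
  one := ((1 : Γ), (0 : M))

@[ext]
lemma ext {x y : ThetaExtension θ} (h₁ : x.1 = y.1) (h₂ : x.2 = y.2) : x = y := Prod.ext h₁ h₂

@[simp] lemma fst_add (x y : ThetaExtension θ) : (x + y).1 = x.1 + y.1 := rfl
@[simp] lemma snd_add (x y : ThetaExtension θ) : (x + y).2 = x.2 + y.2 := rfl
@[simp] lemma fst_zero : (0 : ThetaExtension θ).1 = 0 := rfl
@[simp] lemma snd_zero : (0 : ThetaExtension θ).2 = 0 := rfl
@[simp] lemma fst_one : (1 : ThetaExtension θ).1 = 1 := rfl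
@[simp] lemma snd_one : (1 : ThetaExtension θ).2 = 0 := rfl
@[simp] lemma fst_mul (x y : ThetaExtension θ) : (x * y).1 = x.1 * y.1 := rfl
@[simp] lemma snd_mul (x y : ThetaExtension θ) : (x * y).2 =
    x.1 • y.2 + op y.1 • x.2 + θ.toHom (BalancedTensor.tmul Γ x.2 y.2) := rfl

instance : Ring (ThetaExtension θ) where
  __ := (inferInstance : AddCommGroup (ThetaExtension θ))
  mul_assoc x y z := by
    ext
    · simp [mul_assoc]
    · simp only [snd_mul, fst_mul, smul_add, BalancedTensor.add_tmul, BalancedTensor.tmul_add,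
        map_add, θ.assoc, ← BalancedTensor.smul_tmul_left, ← BalancedTensor.smul_tmul_right,
        BalancedTensor.smul_tmul, θ.map_smul_left, θ.map_smul_right, mul_smul, op_mul,
        smul_comm x.1 (op z.1) y.2]
      abel
  one_mul x := by ext <;> simp [BalancedTensor.zero_tmul]
  mul_one x := by ext <;> simp [BalancedTensor.tmul_zero]
  zero_mul x := by ext <;> simp [BalancedTensor.zero_tmul]
  mul_zero x := by ext <;> simp [BalancedTensor.tmul_zero]
  left_distrib x y z := by
    ext
    · simp [mul_add]
    · simp only [snd_mul, snd_add, fst_add, smul_add, BalancedTensor.tmul_add, map_add, MulOpposite.op_add,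
        add_smul]
      abel
  right_distrib x y z := by
    ext
    · simp [add_mul]
    · simp only [snd_mul, snd_add, fst_add, smul_add, BalancedTensor.add_tmul, map_add, add_smul]
      abel

/-- The ring homomorphism `γ ↦ (γ, 0)`. -/
def inl (θ : AssocBimoduleHom Γ M) : Γ →+* ThetaExtension θ where
  toFun γ := ((γ, 0) : Γ × M)
  map_one' := rfl
  map_zero' := rfl
  map_mul' a b := by
    refine ThetaExtension.ext rfl ?_
    change (0 : M) = a • (0 : M) + op b • (0 : M) + θ.toHom (BalancedTensor.tmul Γ (0 : M) (0 : M))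
    simp [BalancedTensor.zero_tmul]
  map_add' a b := ThetaExtension.ext rfl (add_zero (0 : M)).symm

/-- If `Γ` is right Noetherian and `M` is finitely generated on the right, then `Γ ⋉_θ M` is
right Noetherian. -/
instance isNoetherianRing_op [IsNoetherianRing Γᵐᵒᵖ] [Module.Finite Γᵐᵒᵖ M] :
    IsNoetherianRing (ThetaExtension θ)ᵐᵒᵖ := by
  let : Module Γᵐᵒᵖ (ThetaExtension θ)ᵐᵒᵖ := Module.compHom _ (inl θ).op
  have hs : ∀ (γ : Γᵐᵒᵖ) (x : (ThetaExtension θ)ᵐᵒᵖ), γ • x = op (inl θ γ.unop) * x :=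
    fun _ _ => rfl
  have : IsScalarTower Γᵐᵒᵖ (ThetaExtension θ)ᵐᵒᵖ (ThetaExtension θ)ᵐᵒᵖ :=
    ⟨fun γ x y => by simp only [hs, smul_eq_mul, mul_assoc]⟩
  let e : (Γᵐᵒᵖ × M) →ₗ[Γᵐᵒᵖ] (ThetaExtension θ)ᵐᵒᵖ :=
    { toFun := fun p => op ((p.1.unop, p.2) : Γ × M)
      map_add' := fun _ _ => rfl
      map_smul' := fun γ p => by
        apply unop_injective
        rw [RingHom.id_apply, hs]
        refine ThetaExtension.ext rfl ?_
        change γ • p.2 = p.1.unop • (0 : M) + op γ.unop • p.2 +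
          θ.toHom (BalancedTensor.tmul Γ p.2 (0 : M))
        simp [BalancedTensor.tmul_zero] }
  have he : Function.Surjective e := fun x => ⟨(op x.unop.1, x.unop.2), rfl⟩
  have : IsNoetherian Γᵐᵒᵖ (ThetaExtension θ)ᵐᵒᵖ :=
    isNoetherian_of_surjective (f := e) (LinearMap.range_eq_top.mpr he)
  exact isNoetherian_of_tower Γᵐᵒᵖ this

end ThetaExtension

end ThetaExtension

/-! ### Short exact sequences in an abelian category -/

section Extensions

universe v' u'

variable {C : Type u} [Category.{v} C] [Abelian C] {D : Type u'} [Category.{v'} D] [Abelian D]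

attribute [local instance] Abelian.hasFiniteBiproducts

open ZeroObject

/-! Write Λ for Γ ⋉_θ M. The ring homomorphisms `inl : Γ → Λ` and `fstHom : Λ → Γ` compose to the
identity of Γ, so inflating a Γ-module to Λ and restricting it back changes nothing. Restriction is
thus exact and essentially surjective, and it carries a generator over Λ, with all extensions or
triangles built from it, to such data over Γ. This gives the three lower bounds. For the
Igusa–Todorov distance restriction must also preserve projectives, which holds because Λ is
projective as a right Γ-module when M is.

The upper bounds rest on an operation E on right Λ-modules such that X ⊗_Γ M maps onto E X.
Tensoring the surjections with powers of M shows that Eⁿ X vanishes as soon as the n-th tensor power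
of M does (`isZero_iterate`).

For the extension dimension and the Rouquier dimension, E X = XM. The quotient X/XM is inflated from
Γ, so X is filtered by n layers coming from Γ. A layer costs d + 1 copies of the generator, and
costs add along extensions (`extensionLevel_of_extOf`), giving n(d + 1) in total. The sequence 0 →
XM → X → X/XM → 0 is natural in X, so it applies termwise to bounded complexes and yields triangles;
the functor X ↦ XM need not be exact.

For the Igusa–Todorov distance, E X is the kernel of the counit X ⊗_Γ Λ → X. Projectivity of M on
the left makes – ⊗_Γ Λ exact, and this functor preserves projectives, so it transports syzygies and
their resolutions from Γ. Resolutions of the k-th syzygies of E X and X ⊗_Γ Λ combine into one for a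
k-th syzygy of X, numbers of terms adding up (`exists_resOf_of_extOf_right`). Throughout, the
resolving object is chosen before X. -/

/-- There is a short exact sequence `0 → A → B → Q → 0`. -/
def ExtOf (A B Q : C) : Prop :=
  ∃ (f : A ⟶ B) (g : B ⟶ Q) (w : f ≫ g = 0), (ShortComplex.mk f g w).ShortExact

lemma ExtOf.of_shortExact {S : ShortComplex C} (h : S.ShortExact) : ExtOf S.X₁ S.X₂ S.X₃ :=
  ⟨S.f, S.g, S.zero, h⟩

/-- A criterion for diagram chases: a morphism `T ⟶ B` plays the role of an element of `B`, and
preimages exist after an epimorphic refinement of `T`. -/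
lemma extOf_iff_isZero_left {A B Q : C} (f : A ⟶ B) (g : B ⟶ Q) (w : f ≫ g = 0) :
    (ShortComplex.mk f g w).ShortExact ↔
      Mono f ∧ Epi g ∧ ∀ ⦃T : C⦄ (x : T ⟶ B), x ≫ g = 0 →
        ∃ (T' : C) (π : T' ⟶ T) (_ : Epi π) (y : T' ⟶ A), π ≫ x = y ≫ f := by
  constructor
  · intro h
    exact ⟨h.mono_f, h.epi_g, fun T x hx => h.exact.exact_up_to_refinements x hx⟩
  · rintro ⟨h₁, h₂, h₃⟩
    refine ShortComplex.ShortExact.mk' ?_ h₁ h₂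
    rw [ShortComplex.exact_iff_exact_up_to_refinements]
    exact h₃

lemma ExtOf.of_iso {A B Q A' B' Q' : C} (h : ExtOf A B Q) (a : A ≅ A') (b : B ≅ B')
    (q : Q ≅ Q') : ExtOf A' B' Q' := by
  obtain ⟨f, g, w, h⟩ := h
  refine ⟨a.inv ≫ f ≫ b.hom, b.inv ≫ g ≫ q.hom, by simp [reassoc_of% w], ?_⟩
  exact ShortComplex.shortExact_of_iso
    (ShortComplex.isoMk (S₁ := ShortComplex.mk f g w) a b q (by simp) (by simp)) h

lemma ExtOf.iso_of_isZero_left {A B Q : C} (h : ExtOf A B Q) (hA : IsZero A) :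
    Nonempty (B ≅ Q) := by
  obtain ⟨f, g, w, h⟩ := h
  have := h.isIso_g_iff.mpr hA
  exact ⟨asIso g⟩

lemma ExtOf.iso_of_isZero_right {A B Q : C} (h : ExtOf A B Q) (hQ : IsZero Q) :
    Nonempty (A ≅ B) := by
  obtain ⟨f, g, w, h⟩ := h
  have := h.isIso_f_iff.mpr hQ
  exact ⟨asIso f⟩

lemma ExtOf.kernel {B Q : C} (g : B ⟶ Q) [Epi g] : ExtOf (kernel g) B Q :=
  ⟨kernel.ι g, g, kernel.condition g,
    ShortComplex.ShortExact.mk' (ShortComplex.exact_of_f_is_kernel _ (kernelIsKernel g))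
      inferInstance inferInstance⟩

lemma ExtOf.op {A B Q : C} (h : ExtOf A B Q) :
    ExtOf (Opposite.op Q) (Opposite.op B) (Opposite.op A) := by
  obtain ⟨f, g, w, h⟩ := h
  exact ⟨g.op, f.op, by rw [← op_comp, w, Limits.op_zero], h.op⟩

lemma ExtOf.unop {A B Q : Cᵒᵖ} (h : ExtOf A B Q) : ExtOf Q.unop B.unop A.unop := by
  obtain ⟨f, g, w, h⟩ := h
  exact ⟨g.unop, f.unop, by rw [← unop_comp, w, Limits.unop_zero], h.unop⟩

lemma ExtOf.map {A B Q : C} (h : ExtOf A B Q) (F : C ⥤ D) [F.Additive] [PreservesFiniteLimits F]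
    [PreservesFiniteColimits F] : ExtOf (F.obj A) (F.obj B) (F.obj Q) := by
  obtain ⟨f, g, w, h⟩ := h
  exact ⟨F.map f, F.map g, by rw [← F.map_comp, w, F.map_zero], h.map_of_exact F⟩

/-- `B/U` is an extension of `B/A` by `A/U`. -/
lemma ExtOf.exists_quotient {U A V B Q : C} (h : ExtOf U A V) (h' : ExtOf A B Q) :
    ∃ X, ExtOf U B X ∧ ExtOf V X Q := by
  obtain ⟨u, v, w, h⟩ := h
  obtain ⟨f, g, w', h'⟩ := h'
  have := h.mono_f; have := h.epi_g; have := h'.mono_f; have := h'.epi_g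
  dsimp at *
  let p := Limits.cokernel.π (u ≫ f)
  have hp : (u ≫ f) ≫ p = 0 := cokernel.condition _
  have hup : (ShortComplex.mk _ _ hp).ShortExact := by
    exact ShortComplex.ShortExact.mk'
      (ShortComplex.exact_of_g_is_cokernel _ (cokernelIsCokernel _)) (mono_comp u f) inferInstance
  refine ⟨Limits.cokernel (u ≫ f), ⟨_, _, hp, hup⟩, h.exact.desc (f ≫ p) (by simpa using hp),
    Limits.cokernel.desc _ g (by simp [w']), ?_, ?_⟩
  · rw [← cancel_epi v]
    rw [h.exact.g_desc_assoc]
    simp [p, w']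
  rw [extOf_iff_isZero_left]
  have hd : v ≫ h.exact.desc (f ≫ p) (by simpa using hp) = f ≫ p := h.exact.g_desc _ _
  refine ⟨Preadditive.mono_of_cancel_zero _ ?_, epi_of_epi_fac (cokernel.π_desc _ _ _), ?_⟩
  · intro T x hx
    obtain ⟨T₁, π₁, _, a, ha⟩ := surjective_up_to_refinements_of_epi v x
    have h1 : (a ≫ f) ≫ p = 0 := by
      rw [Category.assoc, ← hd, ← Category.assoc, ← ha, Category.assoc, hx, comp_zero]
    obtain ⟨T₂, π₂, _, b, hb⟩ := hup.exact.exact_up_to_refinements (a ≫ f) h1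
    dsimp at hb
    have h2 : π₂ ≫ a = b ≫ u := by
      rw [← cancel_mono f]; simpa using hb
    rw [← cancel_epi π₁, ha, ← cancel_epi π₂, ← Category.assoc, h2]
    simp [w]
  · intro T x hx
    obtain ⟨T₁, π₁, _, b, hb⟩ := surjective_up_to_refinements_of_epi p x
    have h1 : b ≫ g = 0 := by
      have : p ≫ Limits.cokernel.desc (u ≫ f) g (by simp [w']) = g := cokernel.π_desc _ _ _
      rw [← this, ← Category.assoc, ← hb, Category.assoc, hx, comp_zero]
    obtain ⟨T₂, π₂, _, a, ha⟩ := h'.exact.exact_up_to_refinements b h1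
    dsimp at ha
    refine ⟨T₂, π₂ ≫ π₁, inferInstance, a ≫ v, ?_⟩
    rw [Category.assoc, hb, ← Category.assoc, ha, Category.assoc, Category.assoc, hd]

/-- The kernel of a composition of epimorphisms is an extension of their kernels. -/
lemma ExtOf.exists_kernel {K V A A' Q : C} (h : ExtOf K V A) (h' : ExtOf A' A Q) :
    ∃ N, ExtOf N V Q ∧ ExtOf K N A' := by
  -- This is the quotient statement in the opposite category.
  obtain ⟨X, h₁, h₂⟩ := h'.op.exists_quotient h.op
  exact ⟨X.unop, h₁.unop, h₂.unop⟩

/-- An extension of `Q` by a retract of `A'` is a retract of an extension of `Q` by `A'`. -/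
lemma ExtOf.exists_retract_left {A B Q A' : C} (h : ExtOf A B Q) (r : Retract A A') :
    ∃ B', ExtOf A' B' Q ∧ Nonempty (Retract B B') := by
  obtain ⟨f, g, w, h⟩ := h
  have := h.mono_f; have := h.epi_g
  dsimp at *
  -- `B'` is the pushout of the extension along `r.i`; the maps `𝟙 B` and `r.r ≫ f` agree on `A` and
  -- retract it onto `B`.
  let d : pushout f r.i ⟶ Q := pushout.desc g 0 (by rw [w, comp_zero])
  have hd : pushout.inl f r.i ≫ d = g := pushout.inl_desc _ _ _
  have w' : pushout.inr f r.i ≫ d = 0 := pushout.inr_desc _ _ _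
  have hr : f ≫ 𝟙 B = r.i ≫ r.r ≫ f := by simp
  refine ⟨pushout f r.i, ⟨pushout.inr f r.i, d, w', ?_⟩,
    ⟨⟨pushout.inl f r.i, pushout.desc (𝟙 _) (r.r ≫ f) hr, pushout.inl_desc _ _ _⟩⟩⟩
  have : Epi d := epi_of_epi_fac hd
  have hf {Z : C} (k : pushout f r.i ⟶ Z) (hk : pushout.inr f r.i ≫ k = 0) :
      f ≫ pushout.inl f r.i ≫ k = 0 := by
    rw [pushout.condition_assoc, hk, comp_zero]
  refine ShortComplex.ShortExact.mk' (ShortComplex.exact_of_g_is_cokernel _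
    (CokernelCofork.IsColimit.ofπ _ _ (fun k hk => h.exact.desc _ (hf k hk)) ?_ ?_))
    inferInstance inferInstance
  · intro Z k hk
    have h1 : g ≫ h.exact.desc _ (hf k hk) = _ := h.exact.g_desc _ _
    apply pushout.hom_ext
    · rw [reassoc_of% hd, h1]
    · rw [reassoc_of% w', zero_comp]
      exact hk.symm
  · intro Z k hk m hm
    have h1 : g ≫ h.exact.desc _ (hf k hk) = _ := h.exact.g_desc _ _
    dsimp at hm ⊢
    rw [← cancel_epi g, h1, ← hm, reassoc_of% hd]

lemma ExtOf.biproduct {ι : Type} [Finite ι] {A B Q : ι → C} (h : ∀ i, ExtOf (A i) (B i) (Q i)) :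
    ExtOf (⨁ A) (⨁ B) (⨁ Q) := by
  choose f g w h using h
  have hm := fun i => (h i).mono_f
  have he := fun i => (h i).epi_g
  dsimp at hm he
  have hmono : Mono (biproduct.map f) := by
    refine Preadditive.mono_of_cancel_zero _ fun {T} x hx => ?_
    ext i
    rw [← cancel_mono (f i)]
    simpa using hx =≫ biproduct.π _ i
  have hepi : Epi (biproduct.map g) := by
    refine Preadditive.epi_of_cancel_zero _ fun {T} x hx => ?_
    ext i
    rw [← cancel_epi (g i)]
    simpa using biproduct.ι _ i ≫= hx
  refine ⟨biproduct.map f, biproduct.map g, by ext; simp [w], ?_⟩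
  refine ShortComplex.ShortExact.mk' (ShortComplex.exact_of_f_is_kernel _
    (KernelFork.IsLimit.ofι _ _
      (fun k hk => biproduct.lift fun i => (h i).exact.lift (k ≫ biproduct.π _ i) ?_) ?_ ?_))
      hmono hepi
  · simpa using hk =≫ biproduct.π _ i
  · intro T k hk
    dsimp
    ext i
    simpa using (h i).exact.lift_f _ _
  · intro T k hk m hm'
    rw [← cancel_mono (biproduct.map f), hm']
    dsimp
    ext i
    simpa using ((h i).exact.lift_f _ _).symm

/-- The horseshoe construction, for an extension of `Q` by `A`, an epimorphism onto `A` and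
an epimorphism from a projective object onto `Q`. -/
lemma ExtOf.horseshoe {K V A B Q L P : C} [Projective P] (h₁ : ExtOf K V A) (h : ExtOf A B Q)
    (h₃ : ExtOf L P Q) : ∃ N, ExtOf N (V ⊞ P) B ∧ ExtOf K N L := by
  obtain ⟨i, p, wp, h₁⟩ := h₁
  obtain ⟨f, g, w, h⟩ := h
  obtain ⟨j, q, wq, h₃⟩ := h₃
  have := h.mono_f; have := h.epi_g; have := h₁.mono_f; have := h₁.epi_g; have := h₃.mono_f
  have := h₃.epi_g
  dsimp at *
  -- Only `P` has to be projective: it lifts through `g`, whereas `V` reaches `B` through `A`.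
  let t : P ⟶ B := Projective.factorThru q g
  have ht : t ≫ g = q := Projective.factorThru_comp _ _
  let e : V ⊞ P ⟶ B := biprod.desc (p ≫ f) t
  have heg : e ≫ g = biprod.snd ≫ q := by
    ext <;> simp [e, w, ht]
  have he : Epi e := by
    rw [epi_iff_surjective_up_to_refinements]
    intro T b
    obtain ⟨T₁, π₁, _, y, hy⟩ := surjective_up_to_refinements_of_epi q (b ≫ g)
    have h0 : (π₁ ≫ b - y ≫ t) ≫ g = 0 := by simp [ht, hy]
    obtain ⟨T₂, π₂, _, a, ha⟩ := h.exact.exact_up_to_refinements _ h0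
    obtain ⟨T₃, π₃, _, z, hz⟩ := surjective_up_to_refinements_of_epi p a
    dsimp at ha
    refine ⟨T₃, π₃ ≫ π₂ ≫ π₁, inferInstance, biprod.lift z (π₃ ≫ π₂ ≫ y), ?_⟩
    have : π₂ ≫ π₁ ≫ b = a ≫ f + π₂ ≫ y ≫ t := by
      rw [← ha]; simp
    simp [e, this, reassoc_of% hz]
  have hι : Limits.kernel.ι e ≫ e = 0 := kernel.condition e
  have hs : (Limits.kernel.ι e ≫ biprod.snd) ≫ q = 0 := by
    rw [Category.assoc, ← heg, ← Category.assoc, hι, zero_comp]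
  refine ⟨Limits.kernel e, ExtOf.kernel e, kernel.lift e (i ≫ biprod.inl) (by simp [e, reassoc_of% wp]),
    h₃.exact.lift (Limits.kernel.ι e ≫ biprod.snd) hs, ?_, ?_⟩
  · rw [← cancel_mono j, Category.assoc, h₃.exact.lift_f]
    simp
  have hl := h₃.exact.lift_f (Limits.kernel.ι e ≫ biprod.snd) hs
  dsimp at hl
  rw [extOf_iff_isZero_left]
  refine ⟨?_, ?_, ?_⟩
  · have : Mono (kernel.lift e (i ≫ biprod.inl) (by simp [e, reassoc_of% wp]) ≫
        Limits.kernel.ι e) := by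
      rw [kernel.lift_ι]
      exact mono_comp _ _
    exact mono_of_mono _ (Limits.kernel.ι e)
  · rw [epi_iff_surjective_up_to_refinements]
    intro T x
    have h0 : (x ≫ j ≫ t) ≫ g = 0 := by simp [ht, wq]
    obtain ⟨T₁, π₁, _, a, ha⟩ := h.exact.exact_up_to_refinements _ h0
    obtain ⟨T₂, π₂, _, z, hz⟩ := surjective_up_to_refinements_of_epi p a
    dsimp at ha
    -- The image of `x` under `t` lies in `A`; subtracting a preimage `z` in `V` gives an element of
    -- the kernel of `e` over `x`.
    refine ⟨T₂, π₂ ≫ π₁, inferInstance, kernel.lift e (biprod.lift (-z) (π₂ ≫ π₁ ≫ x ≫ j)) ?_, ?_⟩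
    · simp only [e, biprod.lift_desc, Preadditive.neg_comp, Category.assoc]
      rw [ha, reassoc_of% hz]
      simp
    · rw [← cancel_mono j]
      simp [hl]
  · intro T x hx
    have h0 : (x ≫ Limits.kernel.ι e) ≫ biprod.snd = 0 := by
      rw [Category.assoc, ← hl, reassoc_of% hx, zero_comp]
    have h1 : (x ≫ Limits.kernel.ι e) ≫ biprod.fst ≫ p ≫ f = 0 := by
      have h2 : biprod.fst ≫ p ≫ f = e - biprod.snd ≫ t := by
        ext <;> simp [e]
      rw [h2, Preadditive.comp_sub, ← Category.assoc _ biprod.snd t, h0]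
      simp
    have h2 : (x ≫ Limits.kernel.ι e ≫ biprod.fst) ≫ p = 0 := by
      rw [← cancel_mono f]; simpa using h1
    obtain ⟨T₁, π₁, _, y, hy⟩ := h₁.exact.exact_up_to_refinements _ h2
    dsimp at hy
    refine ⟨T₁, π₁, inferInstance, y, ?_⟩
    rw [← cancel_mono (Limits.kernel.ι e)]
    ext
    · simpa using hy
    · simpa using π₁ ≫= h0

/-- The middle term is the pullback of `L` and `P` over `Q`, which splits over the projective `P`.
It is the horseshoe in which the epimorphism onto `K` is the identity, so that the kernel `N` is
`O`. -/
lemma ExtOf.rotate {K L Q O P : C} [Projective P] (h : ExtOf K L Q) (h' : ExtOf O P Q) :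
    ExtOf O (K ⊞ P) L := by
  obtain ⟨N, h₁, h₂⟩ := ExtOf.horseshoe
    (K := (0 : C)) (V := K) (A := K) ⟨0, 𝟙 K, by simp, by
      rw [extOf_iff_isZero_left]
      refine ⟨⟨fun a b _ => (isZero_zero C).eq_of_tgt _ _⟩, inferInstance, fun T x hx =>
        ⟨T, 𝟙 T, inferInstance, 0, by simpa using hx⟩⟩⟩ h h'
  obtain ⟨i⟩ := h₂.iso_of_isZero_left (isZero_zero C)
  exact h₁.of_iso i (Iso.refl _) (Iso.refl _)

lemma ExtOf.biprod_right {A B Q : C} (h : ExtOf A B Q) (P : C) : ExtOf A (B ⊞ P) (Q ⊞ P) := by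
  obtain ⟨f, g, w, h⟩ := h
  have := h.mono_f; have := h.epi_g
  dsimp at *
  refine ⟨f ≫ biprod.inl, biprod.map g (𝟙 P), by simp [reassoc_of% w], ?_⟩
  rw [extOf_iff_isZero_left]
  refine ⟨mono_comp _ _, inferInstance, fun T x hx => ?_⟩
  have h1 : (x ≫ biprod.fst) ≫ g = 0 := by simpa using hx =≫ biprod.fst
  have h2 : x ≫ biprod.snd = 0 := by simpa using hx =≫ biprod.snd
  obtain ⟨T', π, hπ, y, hy⟩ := h.exact.exact_up_to_refinements _ h1
  dsimp at hy
  refine ⟨T', π, hπ, y, ?_⟩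
  ext
  · simpa using hy
  · simpa using π ≫= h2

end Extensions

/-! ### Additive closures, extension levels and resolutions -/

section AddClosure

universe v' u'

variable {C : Type u} [Category.{v} C] [Abelian C] {D : Type u'} [Category.{v'} D] [Abelian D]

attribute [local instance] Abelian.hasFiniteBiproducts

open ZeroObject

lemma addClosure_of_finite {U : ObjectProperty C} {ι : Type} [Finite ι] {X : C} (Y : ι → C)
    (hY : ∀ i, U (Y i)) (r : Retract X (⨁ Y)) : addClosure U X := by
  obtain ⟨k, ⟨e⟩⟩ := Finite.exists_equiv_fin ι
  refine ⟨k, Y ∘ e.symm, fun i => hY _, ⟨r.trans (Retract.ofIso ?_)⟩⟩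
  exact biproduct.whiskerEquiv e (fun j => eqToIso (by simp))

lemma le_addClosure (U : ObjectProperty C) : U ≤ addClosure U := fun X hX =>
  addClosure_of_finite (ι := Unit) (fun _ => X) (fun _ => hX)
    ⟨biproduct.ι (fun _ : Unit => X) (), biproduct.π (fun _ : Unit => X) (), by simp⟩

lemma addClosure_of_retract {U : ObjectProperty C} {X Y : C} (r : Retract X Y)
    (hY : addClosure U Y) : addClosure U X := by
  obtain ⟨k, Z, hZ, ⟨s⟩⟩ := hY
  exact ⟨k, Z, hZ, ⟨r.trans s⟩⟩

lemma addClosure_mono {U V : ObjectProperty C} (h : U ≤ V) : addClosure U ≤ addClosure V := by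
  rintro X ⟨k, Y, hY, r⟩
  exact ⟨k, Y, fun i => h _ (hY i), r⟩

/-- A retract of each summand gives a retract of the biproducts. -/
noncomputable def CategoryTheory.Retract.biproductMap {ι : Type} [Finite ι] {X Y : ι → C}
    (r : ∀ i, Retract (X i) (Y i)) : Retract (⨁ X) (⨁ Y) where
  i := biproduct.map fun i => (r i).i
  r := biproduct.map fun i => (r i).r
  retract := by ext; simp

lemma addClosure_addClosure (U : ObjectProperty C) : addClosure (addClosure U) ≤ addClosure U := by
  rintro X ⟨k, Y, hY, ⟨r⟩⟩
  choose l Z hZ s using hY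
  refine addClosure_of_finite (ι := Σ i : Fin k, Fin (l i)) (fun p => Z p.1 p.2)
    (fun p => hZ _ _) ?_
  exact (r.trans (Retract.biproductMap fun i => (s i).some)).trans
    (Retract.ofIso (biproductBiproductIso (fun i : Fin k => Fin (l i)) (fun i j => Z i j)))

lemma addClosure_le_addClosure {U V : ObjectProperty C} (h : U ≤ addClosure V) :
    addClosure U ≤ addClosure V :=
  (addClosure_mono h).trans (addClosure_addClosure V)

lemma addClosure_biprod {U : ObjectProperty C} {X Y : C} (hX : addClosure U X)
    (hY : addClosure U Y) : addClosure U (X ⊞ Y) := by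
  apply addClosure_addClosure
  let Z : Bool → C := fun b => bif b then X else Y
  refine addClosure_of_finite Z (fun b => by cases b <;> assumption)
    ⟨biprod.desc (biproduct.ι Z true) (biproduct.ι Z false),
      biprod.lift (biproduct.π Z true) (biproduct.π Z false), ?_⟩
  ext <;> simp <;> rfl

lemma addClosure_map {U : ObjectProperty C} {V : ObjectProperty D} (F : C ⥤ D) [F.Additive]
    (h : ∀ X, U X → V (F.obj X)) {X : C} (hX : addClosure U X) : addClosure V (F.obj X) := by
  obtain ⟨k, Y, hY, ⟨r⟩⟩ := hX
  exact ⟨k, fun i => F.obj (Y i), fun i => h _ (hY i),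
    ⟨(r.map F).trans (Retract.ofIso (F.mapBiproduct Y))⟩⟩

lemma singleton_map {C : Type u} [Category.{v} C] {D : Type u'} [Category.{v'} D] (F : C ⥤ D) (T X : C) (h : ObjectProperty.singleton T X) :
    ObjectProperty.singleton (F.obj T) (F.obj X) := by
  rw [ObjectProperty.singleton_iff] at h ⊢
  rw [h]

/-! ### Extension levels -/

lemma extensionLevel_add_two (U : ObjectProperty C) (n : ℕ) : extensionLevel U (n + 2) =
    addClosure fun A => ∃ S : ShortComplex C, S.ShortExact ∧ addClosure U S.X₁ ∧
      extensionLevel U (n + 1) S.X₃ ∧ S.X₂ = A := rfl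

lemma addClosure_extensionLevel_le (U : ObjectProperty C) (n : ℕ) :
    addClosure (extensionLevel U n) ≤ extensionLevel U n := by
  match n with
  | 0 =>
    rintro X ⟨k, Y, hY, ⟨r⟩⟩
    change IsZero X
    rw [IsZero.iff_id_eq_zero, ← r.retract]
    have : IsZero (⨁ Y) := by
      rw [IsZero.iff_id_eq_zero]
      ext i j
      exact (show IsZero (Y _) from hY _).eq_of_src _ _
    rw [this.eq_of_src r.r 0, comp_zero]
  | 1 => exact addClosure_addClosure U
  | n + 2 =>
    rw [extensionLevel_add_two]
    exact addClosure_addClosure _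

lemma extensionLevel_of_retract {U : ObjectProperty C} {n : ℕ} {X Y : C} (r : Retract X Y)
    (h : extensionLevel U n Y) : extensionLevel U n X :=
  addClosure_extensionLevel_le U n _ (addClosure_of_retract r (le_addClosure _ _ h))

lemma extensionLevel_biproduct {U : ObjectProperty C} {n k : ℕ} {X : Fin k → C}
    (h : ∀ i, extensionLevel U n (X i)) : extensionLevel U n (⨁ X) :=
  addClosure_extensionLevel_le U n _ ⟨k, X, h, ⟨Retract.refl _⟩⟩

lemma extensionLevel_add_two_of_extOf {U : ObjectProperty C} {n : ℕ} {A X B : C}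
    (h : ExtOf A X B) (hA : addClosure U A) (hB : extensionLevel U (n + 1) B) :
    extensionLevel U (n + 2) X := by
  obtain ⟨f, g, w, h⟩ := h
  rw [extensionLevel_add_two]
  exact le_addClosure _ _ ⟨_, h, hA, hB, rfl⟩

/-- The finitely many extensions in the definition add up to a single one, since each level is
closed under finite direct sums. -/
lemma exists_extOf_of_extensionLevel {U : ObjectProperty C} {n : ℕ} {X : C}
    (h : extensionLevel U (n + 2) X) : ∃ A Y B, Nonempty (Retract X Y) ∧ ExtOf A Y B ∧
      addClosure U A ∧ extensionLevel U (n + 1) B := by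
  obtain ⟨k, Y, hY, r⟩ := h
  choose S hS h₁ h₃ h₂ using hY
  refine ⟨⨁ (fun i => (S i).X₁), ⨁ Y, ⨁ (fun i => (S i).X₃), r, ?_,
    extensionLevel_biproduct (n := 1) h₁, extensionLevel_biproduct h₃⟩
  obtain rfl : Y = fun i => (S i).X₂ := funext fun i => (h₂ i).symm
  exact ExtOf.biproduct fun i => ExtOf.of_shortExact (hS i)

/-- The levels are additive along extensions. -/
lemma extensionLevel_of_extOf {U : ObjectProperty C} (a : ℕ) {b : ℕ} {A X B : C}
    (h : ExtOf A X B) (hA : extensionLevel U a A) (hB : extensionLevel U b B) :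
    extensionLevel U (b + a) X := by
  induction a generalizing A X B with
  | zero =>
    obtain ⟨e⟩ := h.iso_of_isZero_left hA
    exact extensionLevel_of_retract (Retract.ofIso e) hB
  | succ a ih =>
    cases a with
    | zero =>
      cases b with
      | zero =>
        obtain ⟨e⟩ := h.iso_of_isZero_right hB
        exact extensionLevel_of_retract (n := 0 + 1) (Retract.ofIso e.symm) hA
      | succ b => exact extensionLevel_add_two_of_extOf h hA hB
    | succ a =>
      obtain ⟨V, Y, W, ⟨r⟩, hY, hV, hW⟩ := exists_extOf_of_extensionLevel hA
      -- Levels are built by splitting off a subobject in `add U`. After replacing `A` by `Y`,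
      -- dividing `X'` by `V` leaves an extension `Z` of `B` by `W`, to which induction applies.
      obtain ⟨X', h', ⟨r'⟩⟩ := h.exists_retract_left r
      obtain ⟨Z, h₁, h₂⟩ := hY.exists_quotient h'
      exact extensionLevel_of_retract r'
        (extensionLevel_add_two_of_extOf (n := b + a) h₁ hV (ih h₂ hW hB))

lemma extensionLevel_map {U : ObjectProperty C} {V : ObjectProperty D} (F : C ⥤ D) [F.Additive]
    [PreservesFiniteLimits F] [PreservesFiniteColimits F] (h : ∀ X, U X → V (F.obj X)) (n : ℕ)
    {X : C} (hX : extensionLevel U n X) : extensionLevel V n (F.obj X) := by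
  induction n generalizing X with
  | zero => exact F.map_isZero hX
  | succ n ih =>
    cases n with
    | zero => exact addClosure_map F h hX
    | succ n =>
      obtain ⟨A, Y, B, ⟨r⟩, hY, hA, hB⟩ := exists_extOf_of_extensionLevel hX
      exact extensionLevel_of_retract (r.map F)
        (extensionLevel_add_two_of_extOf (hY.map F) (addClosure_map F h hA) (ih hB))

lemma iInf_natCast_le_of_imp {P Q : ℕ → Prop} (h : ∀ d, P d → Q d) :
    (⨅ (d : ℕ) (_ : Q d), (d : ℕ∞)) ≤ ⨅ (d : ℕ) (_ : P d), (d : ℕ∞) :=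
  le_iInf₂ fun d hd => iInf₂_le d (h d hd)

/-- A finite infimum is attained; an infinite one makes the right side infinite because `n` is
positive. -/
lemma iInf_natCast_le_mul_sub_one {P Q : ℕ → Prop} {n : ℕ} (hn : 0 < n)
    (h : ∀ d, P d → Q (n * (d + 1) - 1)) :
    (⨅ (d : ℕ) (_ : Q d), (d : ℕ∞)) ≤ n * ((⨅ (d : ℕ) (_ : P d), (d : ℕ∞)) + 1) - 1 := by
  classical
  by_cases hP : ∃ d, P d
  · have h₁ : (⨅ (d : ℕ) (_ : P d), (d : ℕ∞)) = (Nat.find hP : ℕ) :=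
      le_antisymm (iInf₂_le _ (Nat.find_spec hP))
        (le_iInf₂ fun d hd => Nat.cast_le.mpr (Nat.find_min' hP hd))
    rw [h₁]
    refine (iInf₂_le _ (h _ (Nat.find_spec hP))).trans ?_
    norm_cast
  · have h₁ : (⨅ (d : ℕ) (_ : P d), (d : ℕ∞)) = ⊤ := by
      simp only [not_exists] at hP
      simp [hP]
    rw [h₁, top_add, ENat.mul_top (by exact_mod_cast hn.ne'), ENat.top_sub_one]
    exact le_top

theorem extensionDimension_le_of_exact (F : D ⥤ C) [F.Additive] [PreservesFiniteLimits F]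
    [PreservesFiniteColimits F] [F.EssSurj] : extensionDimension C ≤ extensionDimension D := by
  refine iInf_natCast_le_of_imp ?_
  rintro d ⟨T, hT⟩
  exact ⟨F.obj T, fun X => extensionLevel_of_retract (Retract.ofIso (F.objObjPreimageIso X).symm)
    (extensionLevel_map F (singleton_map F T) _ (hT _))⟩

/-- If every object of `D` has a filtration of length `n` with layers in the image of an exact
functor `C ⥤ D`, then the extension dimension of `D` is bounded in terms of that of `C`. -/
theorem extensionDimension_le_of_filtration (Z : C ⥤ D) [Z.Additive] [PreservesFiniteLimits Z]
    [PreservesFiniteColimits Z] (E : D → D) (Q : D → C)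
    (hE : ∀ X, ExtOf (E X) X (Z.obj (Q X))) {n : ℕ} (hn : 0 < n) (h : ∀ X, IsZero (E^[n] X)) :
    extensionDimension D ≤ n * (extensionDimension C + 1) - 1 := by
  refine iInf_natCast_le_mul_sub_one hn ?_
  rintro d ⟨T, hT⟩
  refine ⟨Z.obj T, fun X => ?_⟩
  -- Each of the `j` layers comes from `C` and contributes `d + 1` to the level.
  have key (j : ℕ) (X : D) (hX : IsZero (E^[j] X)) :
      extensionLevel (ObjectProperty.singleton (Z.obj T)) (j * (d + 1)) X := by
    induction j generalizing X with
    | zero =>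
      rw [zero_mul]
      exact hX
    | succ j ih =>
      rw [add_mul, one_mul, add_comm]
      exact extensionLevel_of_extOf _ (hE X) (ih _ hX)
        (extensionLevel_map Z (singleton_map Z T) _ (hT _))
  have := key n X (h X)
  rwa [Nat.sub_add_cancel (Nat.mul_pos hn d.succ_pos)]

/-! ### Resolutions -/

/-- There is an exact sequence `0 → X (s - 1) → ⋯ → X 0 → K → 0` with all `X i` in `V`. -/
def ResOf (V : ObjectProperty C) : ℕ → C → Prop
  | 0, K => IsZero K
  | s + 1, K => ∃ L Y, V Y ∧ ExtOf L Y K ∧ ResOf V s L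

lemma ResOf.mono {V W : ObjectProperty C} (h : V ≤ W) {s : ℕ} {K : C} (hK : ResOf V s K) :
    ResOf W s K := by
  induction s generalizing K with
  | zero => exact hK
  | succ s ih =>
    obtain ⟨L, Y, hY, hL, hL'⟩ := hK
    exact ⟨L, Y, h _ hY, hL, ih hL'⟩

lemma ResOf.of_iso {V : ObjectProperty C} {s : ℕ} {K K' : C} (hK : ResOf V s K) (e : K ≅ K') :
    ResOf V s K' := by
  cases s with
  | zero => exact IsZero.of_iso hK e.symm
  | succ s =>
    obtain ⟨L, Y, hY, hL, hL'⟩ := hK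
    exact ⟨L, Y, hY, hL.of_iso (Iso.refl _) (Iso.refl _) e, hL'⟩

lemma ResOf.map {V : ObjectProperty C} {W : ObjectProperty D} (F : C ⥤ D) [F.Additive]
    [PreservesFiniteLimits F] [PreservesFiniteColimits F] (h : ∀ X, V X → W (F.obj X)) {s : ℕ}
    {K : C} (hK : ResOf V s K) : ResOf W s (F.obj K) := by
  induction s generalizing K with
  | zero => exact F.map_isZero hK
  | succ s ih =>
    obtain ⟨L, Y, hY, hL, hL'⟩ := hK
    exact ⟨_, _, h _ hY, hL.map F, ih hL'⟩

/-- Cut at the kernel of `ε`: the shifted complex resolves it with one term fewer. -/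
lemma ResOf.of_complex {V : ObjectProperty C} (s : ℕ) {K : C} (X : ℕ → C)
    (d : ∀ i, X (i + 1) ⟶ X i) (ε : X 0 ⟶ K) (w₀ : d 0 ≫ ε = 0) (w : ∀ i, d (i + 1) ≫ d i = 0)
    (hV : ∀ i < s, V (X i)) (hX : ∀ i, s ≤ i → IsZero (X i)) (hε : Epi ε)
    (h₀ : (ShortComplex.mk (d 0) ε w₀).Exact)
    (h : ∀ i, (ShortComplex.mk (d (i + 1)) (d i) (w i)).Exact) : ResOf V s K := by
  induction s generalizing K X with
  | zero =>
    rw [ResOf, IsZero.iff_id_eq_zero, ← cancel_epi ε]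
    exact (hX 0 le_rfl).eq_of_src _ _
  | succ s ih =>
    have hl : kernel.lift ε (d 0) w₀ ≫ kernel.ι ε = d 0 := kernel.lift_ι _ _ _
    have w₁ : d 1 ≫ kernel.lift ε (d 0) w₀ = 0 := by
      rw [← cancel_mono (kernel.ι ε), Category.assoc, hl, zero_comp, w 0]
    refine ⟨kernel ε, X 0, hV 0 s.succ_pos, ExtOf.kernel ε,
      ih (fun i => X (i + 1)) (fun i => d (i + 1)) (kernel.lift ε (d 0) w₀) w₁ (fun i => w _)
        (fun i hi => hV _ (by lia)) (fun i hi => hX _ (by lia)) ?_ ?_ (fun i => h _)⟩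
    · rw [epi_iff_surjective_up_to_refinements]
      intro T x
      obtain ⟨T', π, hπ, y, hy⟩ := h₀.exact_up_to_refinements (x ≫ kernel.ι ε) (by simp)
      dsimp at hy
      exact ⟨T', π, hπ, y, by rw [← cancel_mono (kernel.ι ε)]; simpa using hy⟩
    · rw [ShortComplex.exact_iff_exact_up_to_refinements]
      intro T x hx
      dsimp at x hx
      exact (h 0).exact_up_to_refinements x (by
        change x ≫ d 0 = 0
        rw [show d 0 = _ from hl.symm, reassoc_of% hx, zero_comp])

lemma ResOf.exists_complex {V : ObjectProperty C} (s : ℕ) {K : C} (hK : ResOf V s K) :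
    ∃ (X : ℕ → C) (d : ∀ i, X (i + 1) ⟶ X i) (ε : X 0 ⟶ K) (w₀ : d 0 ≫ ε = 0)
      (w : ∀ i, d (i + 1) ≫ d i = 0), (∀ i < s, V (X i)) ∧ (∀ i, s ≤ i → IsZero (X i)) ∧ Epi ε ∧
      (ShortComplex.mk (d 0) ε w₀).Exact ∧
      ∀ i, (ShortComplex.mk (d (i + 1)) (d i) (w i)).Exact := by
  induction s generalizing K with
  | zero =>
    have hK' : IsZero K := hK
    refine ⟨fun _ => K, fun _ => 0, 0, by simp, fun _ => by simp, by simp, fun _ _ => hK',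
      ⟨fun _ _ _ => hK'.eq_of_src _ _⟩, ?_, fun i => ?_⟩
    all_goals exact ShortComplex.exact_of_isZero_X₂ _ hK'
  | succ s ih =>
    obtain ⟨L, Y, hY, ⟨f, g, w, h⟩, hL⟩ := hK
    obtain ⟨X, d, ε, w₀, w₁, h₁, h₂, h₃, h₄, h₅⟩ := ih hL
    have := h.mono_f; have := h.epi_g
    dsimp at *
    refine ⟨fun i => Nat.casesOn i Y X, fun i => Nat.casesOn i (ε ≫ f) d, g, ?_, ?_, ?_, ?_,
      inferInstance, ?_, ?_⟩
    · simp [w]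
    · rintro (_ | i)
      · simp [reassoc_of% w₀]
      · exact w₁ i
    · rintro (_ | i) hi
      · exact hY
      · exact h₁ i (by lia)
    · rintro (_ | i) hi
      · lia
      · exact h₂ i (by lia)
    · rw [ShortComplex.exact_iff_exact_up_to_refinements]
      intro T x hx
      obtain ⟨T₁, π₁, _, y, hy⟩ := h.exact.exact_up_to_refinements x hx
      obtain ⟨T₂, π₂, _, z, hz⟩ := surjective_up_to_refinements_of_epi ε y
      dsimp at hy ⊢
      exact ⟨T₂, π₂ ≫ π₁, inferInstance, z, by rw [Category.assoc, hy, reassoc_of% hz]⟩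
    · rintro (_ | i)
      · rw [ShortComplex.exact_iff_exact_up_to_refinements]
        intro T x hx
        dsimp at x hx ⊢
        have : x ≫ ε = 0 := by
          rw [← cancel_mono f]; simpa using hx
        exact h₄.exact_up_to_refinements x this
      · exact h₅ i

/-- The shift by one is the passage from the length of a resolution to its number of terms; only the
latter is additive. -/
lemma hasResolution_iff_resOf (V : ObjectProperty C) (m : ℕ) (K : C) :
    HasResolution V m K ↔ ResOf V (m + 1) K := by
  constructor
  · rintro ⟨X, d, ε, w₀, w, h₁, h₂, h₃, h₄, h₅⟩
    exact ResOf.of_complex (m + 1) X d ε w₀ w (fun i hi => h₁ i (by lia))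
      (fun i hi => h₂ i (by lia)) h₃ h₄ h₅
  · intro h
    obtain ⟨X, d, ε, w₀, w, h₁, h₂, h₃, h₄, h₅⟩ := ResOf.exists_complex (m + 1) h
    exact ⟨X, d, ε, w₀, w, fun i hi => h₁ i (by lia), fun i hi => h₂ i (by lia), h₃, h₄, h₅⟩

end AddClosure

/-! ### Syzygies and the Igusa–Todorov distance -/

section Syzygies

universe v' u'

variable {C : Type u} [Category.{v} C] [Abelian C] {D : Type u'} [Category.{v'} D] [Abelian D]

attribute [local instance] Abelian.hasFiniteBiproducts

open ZeroObject

/-- `add` of a single object. -/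
abbrev addObj (U : C) : ObjectProperty C := addClosure (ObjectProperty.singleton U)

lemma addObj_self (U : C) : addObj U U := le_addClosure _ _ (by simp)

lemma addObj_le {U : C} {V : ObjectProperty C} (h : addClosure V U) :
    addObj U ≤ addClosure V :=
  addClosure_le_addClosure fun X hX => by
    rw [ObjectProperty.singleton_iff] at hX
    rwa [← hX]

lemma addObj_le_biprod_left (U V : C) : addObj U ≤ addObj (U ⊞ V) :=
  addObj_le (addClosure_of_retract ⟨biprod.inl, biprod.fst, by simp⟩ (addObj_self _))

lemma addObj_le_biprod_right (U V : C) : addObj V ≤ addObj (U ⊞ V) :=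
  addObj_le (addClosure_of_retract ⟨biprod.inr, biprod.snd, by simp⟩ (addObj_self _))

lemma isSyzygy_succ_iff (n : ℕ) (X K : C) : IsSyzygy (n + 1) X K ↔
    ∃ Y P, IsSyzygy n X Y ∧ Projective P ∧ ExtOf K P Y := by
  constructor
  · rintro ⟨Y, hY, S, hS, hP, ⟨e⟩, ⟨e'⟩⟩
    exact ⟨Y, S.X₂, hY, hP, (ExtOf.of_shortExact hS).of_iso e (Iso.refl _) e'⟩
  · rintro ⟨Y, P, hY, hP, ⟨f, g, w, h⟩⟩
    exact ⟨Y, hY, _, h, hP, ⟨Iso.refl _⟩, ⟨Iso.refl _⟩⟩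

lemma IsSyzygy.of_iso {n : ℕ} {X X' K : C} (h : IsSyzygy n X K) (e : X ≅ X') :
    IsSyzygy n X' K := by
  induction n generalizing K with
  | zero =>
    obtain ⟨i⟩ := h
    exact ⟨i ≪≫ e⟩
  | succ n ih =>
    rw [isSyzygy_succ_iff] at h ⊢
    obtain ⟨Y, P, hY, h⟩ := h
    exact ⟨Y, P, ih hY, h⟩

lemma IsSyzygy.map {n : ℕ} {X K : C} (h : IsSyzygy n X K) (F : C ⥤ D) [F.Additive]
    [PreservesFiniteLimits F] [PreservesFiniteColimits F]
    (hF : ∀ P, Projective P → Projective (F.obj P)) : IsSyzygy n (F.obj X) (F.obj K) := by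
  induction n generalizing K with
  | zero =>
    obtain ⟨i⟩ := h
    exact ⟨F.mapIso i⟩
  | succ n ih =>
    rw [isSyzygy_succ_iff] at h ⊢
    obtain ⟨Y, P, hY, hP, h⟩ := h
    exact ⟨_, _, ih hY, hF _ hP, h.map F⟩

lemma isSyzygy_of_isZero (n : ℕ) {X K : C} (hX : IsZero X) (hK : IsZero K) : IsSyzygy n X K := by
  induction n generalizing K with
  | zero => exact ⟨hK.iso hX⟩
  | succ n ih =>
    rw [isSyzygy_succ_iff]
    exact ⟨K, K, ih hK, hK.projective, ⟨𝟙 _, 0, by simp, by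
      rw [extOf_iff_isZero_left]
      exact ⟨inferInstance, ⟨fun _ _ _ => hK.eq_of_src _ _⟩, fun T x _ =>
        ⟨T, 𝟙 _, inferInstance, x, by simp⟩⟩⟩⟩

/-- Syzygies of a short exact sequence `0 → A → B → Q → 0` fit into a short exact sequence
`0 → Ωⁿ A → Ωⁿ B ⊞ P → Ωⁿ Q → 0`. -/
lemma ExtOf.exists_syzygy (n : ℕ) {A B Q K K' : C} (h : ExtOf A B Q) (hA : IsSyzygy n A K)
    (hB : IsSyzygy n B K') :
    ∃ P L, Projective P ∧ IsSyzygy n Q L ∧ ExtOf K (K' ⊞ P) L := by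
  induction n generalizing K K' with
  | zero =>
    obtain ⟨i⟩ := hA
    obtain ⟨j⟩ := hB
    exact ⟨0, Q, inferInstance, ⟨Iso.refl _⟩,
      h.of_iso i.symm (j.symm ≪≫ isoBiprodZero (isZero_zero C)) (Iso.refl _)⟩
  | succ n ih =>
    rw [isSyzygy_succ_iff] at hA hB
    obtain ⟨Y, P, hY, hP, hK⟩ := hA
    obtain ⟨Y', P', hY', hP', hK'⟩ := hB
    obtain ⟨P₀, L, hP₀, hL, h₀⟩ := ih hY hY'
    -- The syzygies of `A` and `B` are prescribed and that of `Q` is constructed: `N` is the kernel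
    -- of `P' ⊞ P₀ ⟶ L`. It is an extension of `Y` by `K'`, and rotating this against `0 → K → P → Y
    -- → 0` gives the claim.
    obtain ⟨N, hN, hN'⟩ := (hK'.biprod_right P₀).exists_kernel h₀
    exact ⟨P, N, hP, (isSyzygy_succ_iff _ _ _).mpr ⟨L, _, hL, inferInstance, hN⟩, hN'.rotate hK⟩

/-- Schanuel's lemma for retracts. -/
lemma ExtOf.retract_of_projective {K P X L R Y : C} [Projective P] [Projective R]
    (h : ExtOf K P X) (h' : ExtOf L R Y) (r : Retract X Y) : Nonempty (Retract K (L ⊞ P)) := by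
  obtain ⟨i, p, w, h⟩ := h
  obtain ⟨j, q, w', h'⟩ := h'
  have := h.mono_f; have := h.epi_g; have := h'.mono_f; have := h'.epi_g
  dsimp at *
  let a : P ⟶ R := Projective.factorThru (p ≫ r.i) q
  let b : R ⟶ P := Projective.factorThru (q ≫ r.r) p
  have ha : a ≫ q = p ≫ r.i := Projective.factorThru_comp _ _
  have hb : b ≫ p = q ≫ r.r := Projective.factorThru_comp _ _
  -- Since `r.i ≫ r.r` is the identity, `a ≫ b` lifts the identity of `X`. So `𝟙 P - a ≫ b` factors
  -- through `K` and corrects the composite `K ⟶ L ⟶ K` to the identity.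
  have hc : (𝟙 P - a ≫ b) ≫ p = 0 := by
    simp [hb, reassoc_of% ha]
  have hf : (i ≫ a) ≫ q = 0 := by simp [ha, reassoc_of% w]
  have hg : (j ≫ b) ≫ p = 0 := by simp [hb, reassoc_of% w']
  have hc' : h.exact.lift _ hc ≫ i = _ := h.exact.lift_f _ _
  have hf' : h'.exact.lift _ hf ≫ j = _ := h'.exact.lift_f _ _
  have hg' : h.exact.lift _ hg ≫ i = _ := h.exact.lift_f _ _
  refine ⟨⟨biprod.lift (h'.exact.lift _ hf) i, biprod.desc (h.exact.lift _ hg)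
    (h.exact.lift _ hc), ?_⟩⟩
  rw [← cancel_mono i, biprod.lift_desc, Preadditive.add_comp, Category.assoc, Category.assoc,
    hg', hc', reassoc_of% hf']
  simp

lemma projective_biproduct {ι : Type} [Finite ι] (P : ι → C) [∀ i, Projective (P i)] :
    Projective (⨁ P) where
  factors f e _ :=
    ⟨biproduct.desc fun i => Projective.factorThru (biproduct.ι P i ≫ f) e, by ext; simp⟩

variable [EnoughProjectives C] {G : C} (hG : ∀ P : C, Projective P → addObj G P)

include hG

/-- By Schanuel, a syzygy of a summand of `Uᵏ` is a summand of copies of one fixed syzygy of `U`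
plus a projective, which `G` absorbs. This is what makes one `U'` serve all objects. -/
lemma exists_syzygy_class (U : C) : ∃ U' : C, addObj U ≤ addObj U' ∧ addObj G ≤ addObj U' ∧
    ∀ K P X, Projective P → ExtOf K P X → addObj U X → addObj U' K := by
  let W : C := U ⊞ G
  let π := Projective.π U
  refine ⟨kernel π ⊞ W, (addObj_le_biprod_left _ _).trans (addObj_le_biprod_right _ _),
    (addObj_le_biprod_right _ _).trans (addObj_le_biprod_right _ _), ?_⟩
  rintro K P X hP h ⟨k, Y, hY, ⟨r⟩⟩
  obtain rfl : Y = fun _ => U := funext fun i => by simpa [eq_comm] using hY i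
  have h' := ExtOf.biproduct fun _ : Fin k => ExtOf.kernel π
  have := projective_biproduct fun _ : Fin k => Projective.over U
  obtain ⟨s⟩ := h.retract_of_projective h' r
  refine addClosure_of_retract s (addClosure_biprod ?_ ?_)
  · exact addObj_le_biprod_left _ _ _ ⟨k, _, fun _ => by simp, ⟨Retract.refl _⟩⟩
  · exact ((addObj_le_biprod_right _ _).trans (addObj_le_biprod_right _ _)) _ (hG _ hP)

/-- Passing to a syzygy keeps the number of terms. Cover `Y` by a projective: the kernel `L` of the
composite onto `X` is an extension of `K` by a syzygy of `Y`, and rotation against a projective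
cover of `K` starts the resolution of `L`. -/
lemma exists_syzygy_resOf (U : C) : ∃ U' : C, ∀ c X, ResOf (addObj U) c X →
    ∃ L P, Projective P ∧ ExtOf L P X ∧ ResOf (addObj U') c L := by
  obtain ⟨U', -, hGU', hU'⟩ := exists_syzygy_class hG U
  refine ⟨U', fun c => ?_⟩
  induction c with
  | zero =>
    intro X hX
    have hX' : IsZero X := hX
    refine ⟨X, X, hX'.projective, ⟨𝟙 _, 0, by simp, ?_⟩, hX⟩
    rw [extOf_iff_isZero_left]
    exact ⟨inferInstance, ⟨fun _ _ _ => hX'.eq_of_src _ _⟩, fun T x _ =>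
        ⟨T, 𝟙 _, inferInstance, x, by simp⟩⟩
  | succ c ih =>
    rintro X ⟨K, Y, hY, hK, hK'⟩
    obtain ⟨O, P, hP, hO, hO'⟩ := ih K hK'
    have hk := ExtOf.kernel (Projective.π Y)
    obtain ⟨L, h₁, h₂⟩ := hk.exists_kernel hK
    exact ⟨L, _, inferInstance, h₁, O, _, addClosure_biprod (hU' _ _ _ inferInstance hk hY)
      (hGU' _ (hG _ hP)), h₂.rotate hO, hO'⟩

/-- The terms are not projective, so the resolution of `Q` cannot be lifted to `B` term by term.
Instead each term resolving `A` is paired with a projective covering `Q`, and `Q` is replaced by its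
syzygy, which still has a resolution with `c` terms. Once `A` is used up, the resolution of the last
syzygy remains. Replacing `Q` changes its resolving object, hence the induction over all `W`. -/
lemma exists_resOf_of_extOf (a : ℕ) (U W : C) : ∃ U' : C, addObj U ≤ addObj U' ∧
    addObj G ≤ addObj U' ∧ ∀ c A B Q, ExtOf A B Q → ResOf (addObj U) a A →
      ResOf (addObj W) c Q → ResOf (addObj U') (c + a) B := by
  induction a generalizing W with
  | zero =>
    refine ⟨W ⊞ (U ⊞ G), (addObj_le_biprod_left _ _).trans (addObj_le_biprod_right _ _),
      (addObj_le_biprod_right _ _).trans (addObj_le_biprod_right _ _), ?_⟩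
    intro c A B Q h hA hQ
    obtain ⟨e⟩ := h.iso_of_isZero_left hA
    exact (hQ.of_iso e.symm).mono (addObj_le_biprod_left _ _)
  | succ a ih =>
    obtain ⟨W', hW'⟩ := exists_syzygy_resOf hG W
    obtain ⟨U', h₁, h₂, h₃⟩ := ih W'
    refine ⟨U', h₁, h₂, ?_⟩
    rintro c A B Q h ⟨A', V, hV, hA, hA'⟩ hQ
    obtain ⟨L, P, hP, hL, hL'⟩ := hW' _ _ hQ
    obtain ⟨N, hN, hN'⟩ := hA.horseshoe h hL
    exact ⟨N, _, addClosure_biprod (h₁ _ hV) (h₂ _ (hG _ hP)), hN, h₃ _ _ _ _ hN' hA' hL'⟩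

/-- The first term `V` over `B` also covers `Q`, with kernel an extension of `A` by `K`; the
previous lemma resolves that kernel. -/
lemma exists_resOf_of_extOf_right (a : ℕ) (U W : C) : ∃ U' : C, ∀ c A B Q, ExtOf A B Q →
    ResOf (addObj U) (a + 1) B → ResOf (addObj W) c A → ResOf (addObj U') (c + (a + 1)) Q := by
  obtain ⟨U', h₁, h₂, h₃⟩ := exists_resOf_of_extOf hG a U W
  refine ⟨U', ?_⟩
  rintro c A B Q h ⟨K, V, hV, hB, hK⟩ hA
  obtain ⟨N, hN, hN'⟩ := hB.exists_kernel h
  exact ⟨N, V, h₁ _ hV, hN, h₃ _ _ _ _ hN' hK hA⟩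

-- The projective summand joins the first term of the resolution, which therefore has to exist:
-- hence `a + 1`.
omit [EnoughProjectives C] in
lemma ResOf.biprod_projective {U : C} {a : ℕ} {K P : C} (hP : Projective P)
    (hK : ResOf (addObj U) (a + 1) K) : ResOf (addObj (U ⊞ G)) (a + 1) (K ⊞ P) := by
  obtain ⟨L, Y, hY, hL, hL'⟩ := hK
  exact ⟨L, _, addClosure_biprod (addObj_le_biprod_left _ _ _ hY)
    (addObj_le_biprod_right _ _ _ (hG _ hP)), hL.biprod_right P,
    hL'.mono (addObj_le_biprod_left _ _)⟩

/-- If every object of `C` has a coresolution-type filtration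
`0 → E X → T (R X) → X → 0` with `Eⁿ X = 0`, where `T : D ⥤ C` is exact and preserves
projective objects, then the Igusa–Todorov distance of `C` is bounded by that of `D`. -/
theorem igusaTodorovDistance_le_of_filtration (T : D ⥤ C) [T.Additive] [PreservesFiniteLimits T]
    [PreservesFiniteColimits T] (hT : ∀ P, Projective P → Projective (T.obj P))
    (E : C → C) (R : C → D) (hE : ∀ X, ExtOf (E X) (T.obj (R X)) X) {n : ℕ} (hn : 0 < n)
    (h : ∀ X, IsZero (E^[n] X)) :
    igusaTodorovDistance C ≤ n * (igusaTodorovDistance D + 1) - 1 := by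
  refine iInf_natCast_le_mul_sub_one hn ?_
  rintro m ⟨k, U, hU⟩
  -- The order `k` of the syzygy stays fixed while the number of terms grows by `m + 1` per step.
  -- The object `U'` depends on `j` but not on `X`.
  have key (j : ℕ) : ∃ U' : C, ∀ X, IsZero (E^[j] X) → ∃ K, IsSyzygy k X K ∧
      ResOf (addObj U') (j * (m + 1)) K := by
    induction j with
    | zero =>
      refine ⟨0, fun X hX => ⟨0, isSyzygy_of_isZero k hX (isZero_zero C), ?_⟩⟩
      rw [zero_mul]
      exact isZero_zero C
    | succ j ih =>
      obtain ⟨W, hW⟩ := ih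
      obtain ⟨U', hU'⟩ := exists_resOf_of_extOf_right hG m (T.obj U ⊞ G) W
      refine ⟨U', fun X hX => ?_⟩
      obtain ⟨K, hK, hK'⟩ := hW _ hX
      obtain ⟨L, hL, hL'⟩ := hU (R X)
      rw [hasResolution_iff_resOf] at hL'
      -- The resolved syzygies of `E X` and `T (R X)` are kept, and a suitable syzygy `N` of `X` is
      -- produced from them.
      obtain ⟨P, N, hP, hN, h₁⟩ := (hE X).exists_syzygy k hK (hL.map T hT)
      have h₂ : ResOf (addObj (T.obj U)) (m + 1) (T.obj L) :=
        hL'.map T fun _ => addClosure_map T (singleton_map T U)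
      refine ⟨N, hN, ?_⟩
      rw [add_mul, one_mul]
      exact hU' _ _ _ _ h₁ (h₂.biprod_projective hG hP) hK'
  obtain ⟨U', hU'⟩ := key n
  refine ⟨k, U', fun X => ?_⟩
  obtain ⟨K, hK, hK'⟩ := hU' X (h X)
  refine ⟨K, hK, ?_⟩
  rw [hasResolution_iff_resOf]
  rwa [Nat.sub_add_cancel (Nat.mul_pos hn m.succ_pos)]

omit [EnoughProjectives C] hG

theorem igusaTodorovDistance_le_of_exact (F : D ⥤ C) [F.Additive] [PreservesFiniteLimits F]
    [PreservesFiniteColimits F] [F.EssSurj] (hF : ∀ P, Projective P → Projective (F.obj P)) :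
    igusaTodorovDistance C ≤ igusaTodorovDistance D := by
  refine iInf_natCast_le_of_imp ?_
  rintro m ⟨k, U, hU⟩
  refine ⟨k, F.obj U, fun X => ?_⟩
  obtain ⟨K, hK, hK'⟩ := hU (F.objPreimage X)
  refine ⟨F.obj K, (hK.map F hF).of_iso (F.objObjPreimageIso X), ?_⟩
  rw [hasResolution_iff_resOf] at hK' ⊢
  exact hK'.map F fun _ => addClosure_map F (singleton_map F U)

end Syzygies

/-! ### Generation in triangulated categories -/

section Triangulated

open Pretriangulated

variable {T : Type*} [Category* T] [HasZeroObject T] [HasShift T ℤ] [Preadditive T]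
  [∀ n : ℤ, (shiftFunctor T n).Additive] [Pretriangulated T]
  {T' : Type*} [Category* T'] [HasZeroObject T'] [HasShift T' ℤ] [Preadditive T']
  [∀ n : ℤ, (shiftFunctor T' n).Additive] [Pretriangulated T']

lemma shiftBinaryProductsRetractClosure_le_inverseImage (F : T ⥤ T') [F.CommShift ℤ]
    [F.IsTriangulated] {P : ObjectProperty T} {Q : ObjectProperty T'} (h : P ≤ Q.inverseImage F) :
    (P.shiftClosure ℤ).binaryProductsClosure.retractClosure ≤
      (Q.shiftClosure ℤ).binaryProductsClosure.retractClosure.inverseImage F := by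
  rintro X ⟨Y, hY, ⟨r⟩⟩
  refine ⟨F.obj Y, ?_, ⟨r.map F⟩⟩
  suffices (P.shiftClosure ℤ).binaryProductsClosure ≤
      (Q.shiftClosure ℤ).binaryProductsClosure.inverseImage F from this _ hY
  have : ((Q.shiftClosure ℤ).binaryProductsClosure.inverseImage F).IsClosedUnderLimitsOfShape
      (Discrete WalkingPair) := by
    refine ⟨?_⟩
    rintro X ⟨p⟩
    exact ObjectProperty.prop_of_isLimit _ (isLimitOfPreserves F p.isLimit)
      (fun j => p.prop_diag_obj j)
  refine ObjectProperty.limitsClosure_le (J := fun _ : Unit => Discrete WalkingPair) ?_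
  rintro X ⟨Y, a, e, hY⟩
  exact ObjectProperty.le_limitsClosure _ _ _
    ⟨F.obj Y, a, F.mapIso e ≪≫ (F.commShiftIso a).app Y, h _ hY⟩

lemma triangEnvelopeIter_le_inverseImage (F : T ⥤ T') [F.CommShift ℤ]
    [F.IsTriangulated] {P : ObjectProperty T} {Q : ObjectProperty T'} (h : P ≤ Q.inverseImage F)
    (n : ℕ) : P.triangEnvelopeIter n ≤ (Q.triangEnvelopeIter n).inverseImage F := by
  induction n with
  | zero =>
    simp only [ObjectProperty.triangEnvelopeIter_zero]
    exact shiftBinaryProductsRetractClosure_le_inverseImage F h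
  | succ n ih =>
    simp only [ObjectProperty.triangEnvelopeIter_succ]
    rintro X ⟨Y, ⟨A, B, f, g, k, hT, hA, hB⟩, ⟨r⟩⟩
    exact ⟨F.obj Y, ⟨F.obj A, F.obj B, _, _, _, F.map_distinguished _ hT,
      shiftBinaryProductsRetractClosure_le_inverseImage F h _ hA, ih _ hB⟩, ⟨r.map F⟩⟩

/-- A distinguished triangle with vertices in a triangulated subcategory is distinguished there. Its
last morphism must be moved along the comparison of the two shifts. -/
lemma extensionProduct_fullSubcategory {P : ObjectProperty T} [P.IsTriangulated]
    {Q R : ObjectProperty P.FullSubcategory} {A X B : P.FullSubcategory}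
    {f : A.obj ⟶ X.obj} {g : X.obj ⟶ B.obj} {h : B.obj ⟶ A.obj⟦(1 : ℤ)⟧}
    (hT : Triangle.mk f g h ∈ distTriang T) (hA : Q A) (hB : R B) :
    ObjectProperty.extensionProduct Q R X := by
  refine ⟨A, B, P.fullyFaithfulι.preimage f, P.fullyFaithfulι.preimage g,
    P.fullyFaithfulι.preimage (X := B) (Y := A⟦(1 : ℤ)⟧)
      (h ≫ (P.ι.commShiftIso (1 : ℤ)).inv.app A), ?_, hA, hB⟩
  refine isomorphic_distinguished _ hT _ (Triangle.isoMk _ _ (Iso.refl _) (Iso.refl _) (Iso.refl _)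
    ?_ ?_ ?_)
  · exact (Category.comp_id f).trans (Category.id_comp f).symm
  · exact (Category.comp_id g).trans (Category.id_comp g).symm
  · change ((h ≫ (P.ι.commShiftIso (1 : ℤ)).inv.app A) ≫ (P.ι.commShiftIso (1 : ℤ)).hom.app A) ≫
      (shiftFunctor T (1 : ℤ)).map (𝟙 A.obj) = 𝟙 B.obj ≫ h
    simp

end Triangulated

/-! ### Bounded derived categories and termwise functors -/

section Bounded

open Pretriangulated DerivedCategory

universe v' u' w w'

variable {C : Type u} [Category.{v} C] [Abelian C]
  {D : Type u'} [Category.{v'} D] [Abelian D]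

/-- A cochain complex concentrated in finitely many degrees. -/
def IsStrictlyBounded (K : CochainComplex C ℤ) : Prop :=
  ∃ a b : ℤ, ∀ i, (i < a ∨ b < i) → IsZero (K.X i)

lemma IsStrictlyBounded.map {K : CochainComplex C ℤ} (hK : IsStrictlyBounded K) (F : C ⥤ D)
    [F.PreservesZeroMorphisms] :
    IsStrictlyBounded ((F.mapHomologicalComplex (ComplexShape.up ℤ)).obj K) := by
  obtain ⟨a, b, h⟩ := hK
  exact ⟨a, b, fun i hi => F.map_isZero (h i hi)⟩

variable [HasDerivedCategory.{w} C] [HasDerivedCategory.{w'} D]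

lemma IsStrictlyBounded.bounded {K : CochainComplex C ℤ} (hK : IsStrictlyBounded K) :
    (TStructure.t : Triangulated.TStructure (DerivedCategory C)).bounded (Q.obj K) := by
  obtain ⟨a, b, h⟩ := hK
  have h₁ : K.IsStrictlyGE a := (K.isStrictlyGE_iff a).mpr fun i hi => h i (Or.inl hi)
  have h₂ : K.IsStrictlyLE b := (K.isStrictlyLE_iff b).mpr fun i hi => h i (Or.inr hi)
  exact ⟨⟨a, inferInstance⟩, ⟨b, inferInstance⟩⟩

/-- Bounded representatives allow merely additive functors to be applied termwise, although these
need not pass to the derived category. -/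
lemma exists_isStrictlyBounded_iso {X : DerivedCategory C}
    (hX : (TStructure.t : Triangulated.TStructure (DerivedCategory C)).bounded X) :
    ∃ K : CochainComplex C ℤ, IsStrictlyBounded K ∧ Nonempty (X ≅ Q.obj K) := by
  obtain ⟨⟨a, ha⟩, ⟨b, hb⟩⟩ := hX
  obtain ⟨K, h₁, h₂, e⟩ := exists_iso_Q_obj_of_isGE_of_isLE X a b
  refine ⟨K, ⟨a, b, ?_⟩, e⟩
  rintro i (hi | hi)
  · exact (K.isStrictlyGE_iff a).mp h₁ i hi
  · exact (K.isStrictlyLE_iff b).mp h₂ i hi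

/-- The object of the bounded derived category given by a bounded complex. -/
noncomputable def IsStrictlyBounded.obj {K : CochainComplex C ℤ} (hK : IsStrictlyBounded K) :
    Bounded C := ⟨Q.obj K, hK.bounded⟩

lemma exists_iso_obj (X : Bounded C) : ∃ (K : CochainComplex C ℤ) (hK : IsStrictlyBounded K),
    Nonempty (X ≅ hK.obj) := by
  obtain ⟨K, hK, ⟨e⟩⟩ := exists_isStrictlyBounded_iso X.property
  exact ⟨K, hK, ⟨ObjectProperty.isoMk _ e⟩⟩

variable (F : C ⥤ D) [F.Additive] [PreservesFiniteLimits F] [PreservesFiniteColimits F]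

lemma bounded_mapDerivedCategory_obj (X : Bounded C) :
    (TStructure.t : Triangulated.TStructure (DerivedCategory D)).bounded
      (F.mapDerivedCategory.obj X.obj) := by
  obtain ⟨K, hK, ⟨e⟩⟩ := exists_isStrictlyBounded_iso X.property
  exact ObjectProperty.prop_of_iso _
    (F.mapDerivedCategory.mapIso e ≪≫ F.mapDerivedCategoryFactors.app K).symm (hK.map F).bounded

/-- The functor between bounded derived categories induced by an exact functor. -/
noncomputable def CategoryTheory.Functor.mapBounded : Bounded C ⥤ Bounded D :=
  ObjectProperty.lift _ (Bounded.ι ⋙ F.mapDerivedCategory) (bounded_mapDerivedCategory_obj F)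

noncomputable instance : F.mapBounded.CommShift ℤ := by
  dsimp only [Functor.mapBounded]
  infer_instance

instance : F.mapBounded.IsTriangulated := by
  dsimp only [Functor.mapBounded]
  infer_instance

/-- The functor induced on bounded derived categories is computed termwise on complexes. -/
noncomputable def CategoryTheory.Functor.mapBoundedObjIso {K : CochainComplex C ℤ}
    (hK : IsStrictlyBounded K) : F.mapBounded.obj hK.obj ≅ (hK.map F).obj :=
  ObjectProperty.isoMk _ (F.mapDerivedCategoryFactors.app K)

/-- If `C` is, up to isomorphism, a retract of `D` via an additive functor `C ⥤ D` and an exact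
functor `D ⥤ C`, then the Rouquier dimension does not increase from `D` to `C`. -/
theorem rouquierDimension_le_of_exact (Z : D ⥤ C) [Z.Additive] (e : Z ⋙ F ≅ 𝟭 D) :
    rouquierDimension (Bounded D) ≤ rouquierDimension (Bounded C) := by
  refine iInf_natCast_le_of_imp ?_
  rintro d ⟨G, hG⟩
  refine ⟨F.mapBounded.obj G, eq_top_iff.mpr fun X _ => ?_⟩
  obtain ⟨K, hK, ⟨i⟩⟩ := exists_iso_obj X
  -- `Z` is applied only to the chosen complex `K`; then `F` returns a complex isomorphic to `K`.
  have h : (ObjectProperty.singleton G).triangEnvelopeIter d (hK.map Z).obj := by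
    rw [hG]
    trivial
  refine ObjectProperty.prop_of_iso _ ?_ (triangEnvelopeIter_le_inverseImage F.mapBounded
    (fun X => singleton_map F.mapBounded G X) d _ h)
  let e₁ : (F.mapHomologicalComplex (ComplexShape.up ℤ)).obj
      ((Z.mapHomologicalComplex (ComplexShape.up ℤ)).obj K) ≅ K :=
    HomologicalComplex.Hom.isoOfComponents (fun j => e.app (K.X j)) (fun i j _ =>
      (e.hom.naturality (K.d i j)).symm)
  let e₂ : ((hK.map Z).map F).obj ≅ hK.obj := ObjectProperty.isoMk _ (Q.mapIso e₁)
  exact F.mapBoundedObjIso (hK.map Z) ≪≫ e₂ ≪≫ i.symm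

/-- A functorial finite filtration of the objects of `D` with layers in the image of an exact
functor `C ⥤ D` bounds the Rouquier dimension of the bounded derived category of `D`. -/
theorem rouquierDimension_le_of_filtration (J : D ⥤ D) [J.Additive] (R : D ⥤ C) [R.Additive]
    (α : J ⟶ 𝟭 D) (β : 𝟭 D ⟶ R ⋙ F) (w : ∀ X, α.app X ≫ β.app X = 0)
    (h : ∀ X, (ShortComplex.mk (α.app X) (β.app X) (w X)).ShortExact) {n : ℕ} (hn : 0 < n)
    (hJ : ∀ X, IsZero (J.obj^[n] X)) :
    rouquierDimension (Bounded D) ≤ n * (rouquierDimension (Bounded C) + 1) - 1 := by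
  refine iInf_natCast_le_mul_sub_one hn ?_
  rintro d ⟨G, hG⟩
  refine ⟨F.mapBounded.obj G, eq_top_iff.mpr fun X _ => ?_⟩
  set E := (ObjectProperty.singleton (F.mapBounded.obj G)).triangEnvelopeIter
  have hE {K : CochainComplex D ℤ} (hK : IsStrictlyBounded K) : E d ((hK.map R).map F).obj := by
    have h' : (ObjectProperty.singleton G).triangEnvelopeIter d (hK.map R).obj := by
      rw [hG]
      trivial
    exact ObjectProperty.prop_of_iso _ (F.mapBoundedObjIso (hK.map R))
      (triangEnvelopeIter_le_inverseImage F.mapBounded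
        (fun X => singleton_map F.mapBounded G X) d _ h')
  -- Naturality of `α` and `β` turns the termwise sequences into a short exact sequence of
  -- complexes.
  let S (K : CochainComplex D ℤ) : ShortComplex (CochainComplex D ℤ) := ShortComplex.mk
    (X₁ := (J.mapHomologicalComplex _).obj K) (X₂ := K)
    (X₃ := (F.mapHomologicalComplex _).obj ((R.mapHomologicalComplex _).obj K))
    { f := fun i => α.app (K.X i), comm' := fun i j _ => (α.naturality (K.d i j)).symm }
    { f := fun i => β.app (K.X i), comm' := fun i j _ => (β.naturality (K.d i j)).symm }
    (by ext i; exact w (K.X i))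
  have hS (K) : (S K).ShortExact := HomologicalComplex.shortExact_of_degreewise_shortExact _
    fun i => h (K.X i)
  -- The index counts extensions, not layers: `j + 1` layers with `d` extensions each and `j`
  -- gluings give `j * (d + 1) + d`. When `j = 0` the subcomplex vanishes, so `K` is its own top
  -- layer.
  have key (j : ℕ) (K : CochainComplex D ℤ) (hK : IsStrictlyBounded K)
      (hJK : ∀ i, IsZero (J.obj^[j + 1] (K.X i))) : E (j * (d + 1) + d) hK.obj := by
    induction j generalizing K with
    | zero =>
      rw [zero_mul, zero_add]
      have : IsIso (S K).g := (hS K).isIso_g_iff.mpr (by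
        rw [IsZero.iff_id_eq_zero]
        ext i
        exact (hJK i).eq_of_src _ _)
      exact ObjectProperty.prop_of_iso _ (ObjectProperty.isoMk _ (Q.mapIso (asIso (S K).g)).symm)
        (hE hK)
    | succ j ih =>
      have h₁ : E (j * (d + 1) + d) (hK.map J).obj := ih ((J.mapHomologicalComplex _).obj K) (hK.map J) fun i => hJK i
      have h₂ := extensionProduct_fullSubcategory (A := (hK.map J).obj) (X := hK.obj)
        (B := ((hK.map R).map F).obj)
        (triangleOfSES_distinguished (hS K)) h₁ (hE hK)
      -- Gluing two objects adds their indices plus one; here these are `j * (d + 1) + d` and `d`.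
      have h₃ := ObjectProperty.triangEnvelopeIter_add
        (P := ObjectProperty.singleton (F.mapBounded.obj G)) (n := j * (d + 1) + d + 1) (m := d) rfl
      change E _ = _ at h₃
      rw [add_mul, one_mul, add_assoc, add_comm (d + 1) d, ← add_assoc,
        show j * (d + 1) + d + (d + 1) = j * (d + 1) + d + 1 + d by lia, h₃]
      exact ObjectProperty.le_retractClosure _ _ h₂
  obtain ⟨K, hK, ⟨i⟩⟩ := exists_iso_obj X
  obtain ⟨n, rfl⟩ := Nat.exists_eq_add_of_le' hn
  have := key n K hK (fun i => hJ _)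
  rw [show (n + 1) * (d + 1) - 1 = n * (d + 1) + d by rw [add_mul]; lia]
  exact ObjectProperty.prop_of_iso _ i.symm this

end Bounded

/-! ### Finitely generated modules over a Noetherian ring -/

section FGModules

variable {R : Type u} [Ring R] [IsNoetherianRing R] {S : Type u} [Ring S] [IsNoetherianRing S]

attribute [local instance] Abelian.hasFiniteBiproducts

instance : (forget₂ (FGModuleCat.{u} R) (ModuleCat.{u} R)).Additive where

lemma FGModuleCat.shortExact_iff (T : ShortComplex (FGModuleCat.{u} R)) : T.ShortExact ↔
    Function.Injective T.f.hom.hom ∧ Function.Exact T.f.hom.hom T.g.hom.hom ∧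
      Function.Surjective T.g.hom.hom := by
  let F := forget₂ (FGModuleCat.{u} R) (ModuleCat.{u} R)
  constructor
  · intro h
    have h' := h.map_of_exact F
    exact ⟨h'.moduleCat_injective_f,
      (ShortComplex.ShortExact.moduleCat_exact_iff_function_exact _).mp h'.exact,
      h'.moduleCat_surjective_g⟩
  · rintro ⟨h₁, h₂, h₃⟩
    have h' : (T.map F).ShortExact := ModuleCat.shortComplex_shortExact _ h₂ h₁ h₃
    have := h'.mono_f; have := h'.epi_g
    exact ShortComplex.ShortExact.mk' ((T.exact_map_iff_of_faithful F).mp h'.exact)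
      (F.mono_of_mono_map h'.mono_f) (F.epi_of_epi_map h'.epi_g)

lemma FGModuleCat.epi_iff_surjective {X Y : FGModuleCat.{u} R} (f : X ⟶ Y) :
    Epi f ↔ Function.Surjective f.hom.hom := by
  let F := forget₂ (FGModuleCat.{u} R) (ModuleCat.{u} R)
  rw [← F.epi_map_iff_epi f, ModuleCat.epi_iff_surjective]
  rfl

lemma FGModuleCat.isZero_iff {R : Type u} [Ring R] (X : FGModuleCat.{u} R) : IsZero X ↔ Subsingleton X := by
  constructor
  · intro h
    refine subsingleton_of_forall_eq 0 fun x => ?_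
    have := congrArg (fun f : X ⟶ X => f.hom.hom x) (h.eq_of_src (𝟙 X) 0)
    exact this
  · intro h
    rw [IsZero.iff_id_eq_zero]
    ext x
    exact Subsingleton.elim _ _

/-- The extension predicate for modules, in terms of linear maps. -/
lemma FGModuleCat.extOf {X Y Z : FGModuleCat.{u} R} (f : X →ₗ[R] Y) (g : Y →ₗ[R] Z)
    (hf : Function.Injective f) (hfg : Function.Exact f g) (hg : Function.Surjective g) :
    ExtOf X Y Z :=
  ⟨FGModuleCat.ofHom f, FGModuleCat.ofHom g, by
    ext x
    exact hfg.apply_apply_eq_zero x,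
    (FGModuleCat.shortExact_iff _).mpr ⟨hf, hfg, hg⟩⟩

/-- An additive functor between categories of finitely generated modules is exact if it
preserves short exact sequences. -/
lemma FGModuleCat.preservesFiniteLimits_and_colimits (F : FGModuleCat.{u} R ⥤ FGModuleCat.{u} S)
    [F.Additive] (h : ∀ T : ShortComplex (FGModuleCat.{u} R), T.ShortExact → (T.map F).ShortExact) :
    PreservesFiniteLimits F ∧ PreservesFiniteColimits F :=
  (F.exact_tfae.out 0 3).mp h

lemma FGModuleCat.projective_of_module_projective (P : FGModuleCat.{u} R)
    [hP : Module.Projective R P] : Projective P where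
  factors {E X} f e he := by
    obtain ⟨g, hg⟩ := Module.projective_lifting_property e.hom.hom f.hom.hom
      ((FGModuleCat.epi_iff_surjective e).mp he)
    exact ⟨FGModuleCat.ofHom g, by ext x; exact LinearMap.congr_fun hg x⟩

lemma FGModuleCat.exists_retract_pi (P : FGModuleCat.{u} R) [hP : Projective P] :
    ∃ (k : ℕ) (i : P →ₗ[R] (Fin k → R)) (r : (Fin k → R) →ₗ[R] P), r ∘ₗ i = LinearMap.id := by
  obtain ⟨k, r, hr⟩ := Module.Finite.exists_fin' R P
  let e : FGModuleCat.of R (Fin k → R) ⟶ P := FGModuleCat.ofHom r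
  have : Epi e := (FGModuleCat.epi_iff_surjective e).mpr hr
  refine ⟨k, (Projective.factorThru (𝟙 P) e).hom.hom, r, ?_⟩
  have := Projective.factorThru_comp (𝟙 P) e
  exact congrArg (fun f : P ⟶ P => f.hom.hom) this

lemma FGModuleCat.module_projective_of_projective (P : FGModuleCat.{u} R) [Projective P] :
    Module.Projective R P := by
  obtain ⟨k, i, r, h⟩ := exists_retract_pi P
  exact Module.Projective.of_split i r h

instance : EnoughProjectives (FGModuleCat.{u} R) where
  presentation X := by
    obtain ⟨k, r, hr⟩ := Module.Finite.exists_fin' R X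
    exact ⟨{
      p := FGModuleCat.of R (Fin k → R)
      projective := FGModuleCat.projective_of_module_projective _
      f := (FGModuleCat.ofHom r : FGModuleCat.of R (Fin k → R) ⟶ FGModuleCat.of R X)
      epi := (FGModuleCat.epi_iff_surjective _).mpr hr }⟩

/-- This supplies the object `G` required by the Igusa–Todorov estimates: the ring itself. -/
lemma FGModuleCat.addObj_of_projective (P : FGModuleCat.{u} R) (hP : Projective P) :
    addObj (FGModuleCat.of R R) P := by
  obtain ⟨k, i, r, h⟩ := exists_retract_pi P
  refine ⟨k, fun _ => FGModuleCat.of R R, fun _ => by simp, ⟨⟨biproduct.lift fun j =>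
    FGModuleCat.ofHom (LinearMap.proj j ∘ₗ i), biproduct.desc fun j =>
    FGModuleCat.ofHom (r ∘ₗ LinearMap.single R (fun _ => R) j), ?_⟩⟩⟩
  rw [biproduct.lift_desc]
  have hs : LinearMap.id = ∑ j : Fin k, (r ∘ₗ LinearMap.single R (fun _ => R) j) ∘ₗ
      (LinearMap.proj j ∘ₗ i) := by
    rw [← h]
    ext x
    simp only [LinearMap.coe_comp, Function.comp_apply, LinearMap.sum_apply, LinearMap.coe_proj,
      Function.eval, ← map_sum]
    congr 1
    ext j
    simp [Finset.sum_apply, Pi.single_apply]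
  apply (forget₂ (FGModuleCat.{u} R) (ModuleCat.{u} R)).map_injective
  rw [Functor.map_sum]
  apply ModuleCat.hom_ext
  rw [ModuleCat.hom_sum]
  exact hs.symm

/-- Restriction of scalars of finitely generated modules along a finite ring homomorphism. -/
noncomputable def FGModuleCat.restrict (f : R →+* S)
    (hf : ∀ X : FGModuleCat.{u} S, ModuleCat.isFG R ((ModuleCat.restrictScalars f).obj X.obj)) :
    FGModuleCat.{u} S ⥤ FGModuleCat.{u} R :=
  ObjectProperty.lift _ (ObjectProperty.ι _ ⋙ ModuleCat.restrictScalars f) hf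

section

variable (f : R →+* S)
  (hf : ∀ X : FGModuleCat.{u} S, ModuleCat.isFG R ((ModuleCat.restrictScalars f).obj X.obj))

instance FGModuleCat.restrict_additive : (FGModuleCat.restrict f hf).Additive where
  map_add := rfl

lemma FGModuleCat.restrict_map_shortExact {T : ShortComplex (FGModuleCat.{u} S)}
    (hT : T.ShortExact) : (T.map (FGModuleCat.restrict f hf)).ShortExact :=
  (shortExact_iff _).mpr ((shortExact_iff T).mp hT)

instance FGModuleCat.restrict_preservesFiniteLimits :
    PreservesFiniteLimits (FGModuleCat.restrict f hf) :=
  (FGModuleCat.preservesFiniteLimits_and_colimits _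
    fun _ hT => FGModuleCat.restrict_map_shortExact f hf hT).1

instance FGModuleCat.restrict_preservesFiniteColimits :
    PreservesFiniteColimits (FGModuleCat.restrict f hf) :=
  (FGModuleCat.preservesFiniteLimits_and_colimits _
    fun _ hT => FGModuleCat.restrict_map_shortExact f hf hT).2

lemma FGModuleCat.restrict_projective
    (h : ∀ X : FGModuleCat.{u} S, Module.Projective S X →
      Module.Projective R ((ModuleCat.restrictScalars f).obj X.obj))
    (P : FGModuleCat.{u} S) (hP : Projective P) :
    Projective ((FGModuleCat.restrict f hf).obj P) := by
  have := FGModuleCat.module_projective_of_projective P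
  have : Module.Projective R ((FGModuleCat.restrict f hf).obj P) := h P this
  exact FGModuleCat.projective_of_module_projective _

end

end FGModules

/-! ### Exactness and associativity of balanced tensor products -/

namespace BalancedTensor

section

variable {Γ : Type u} [Ring Γ] {X X' X'' N N' : Type u} [AddCommGroup X] [Module Γᵐᵒᵖ X]
  [AddCommGroup X'] [Module Γᵐᵒᵖ X'] [AddCommGroup X''] [Module Γᵐᵒᵖ X'']
  [AddCommGroup N] [Module Γ N] [AddCommGroup N'] [Module Γ N']

/-- The homomorphism out of a tensor product given by a balanced biadditive map. -/
def lift {P : Type*} [AddCommGroup P] (f : X →+ N →+ P)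
    (hf : ∀ (x : X) (γ : Γ) (n : N), f (op γ • x) n = f x (γ • n)) :
    BalancedTensor Γ X N →+ P :=
  QuotientAddGroup.lift (balancedRelations Γ X N)
    (TensorProduct.liftAddHom (R := ℤ) f fun r x n => by simp) (by
      rw [balancedRelations, AddSubgroup.closure_le]
      rintro _ ⟨x, γ, n, rfl⟩
      change TensorProduct.liftAddHom (R := ℤ) f _ _ = 0
      simp [hf])

lemma hom_ext {P : Type*} [AddCommGroup P] {f g : BalancedTensor Γ X N →+ P}
    (h : ∀ x n, f (tmul Γ x n) = g (tmul Γ x n)) : f = g := by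
  ext t
  induction t using induction_on with
  | zero => simp
  | tmul x n => exact h x n
  | add a b ha hb => rw [map_add, map_add, ha, hb]

lemma map_surjective {f : X →ₗ[Γᵐᵒᵖ] X'} (hf : Function.Surjective f) :
    Function.Surjective (map Γ f (LinearMap.id : N →ₗ[Γ] N)) := by
  intro t
  induction t using induction_on with
  | zero => exact ⟨0, map_zero _⟩
  | tmul x n =>
    obtain ⟨y, rfl⟩ := hf x
    exact ⟨tmul Γ y n, rfl⟩
  | add a b ha hb =>
    obtain ⟨a', rfl⟩ := ha
    obtain ⟨b', rfl⟩ := hb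
    exact ⟨a' + b', map_add _ _ _⟩

variable (X) in
/-- The contraction `x ⊗ n ↦ x φ(n)` by a linear form `φ`. -/
def contract (φ : N →ₗ[Γ] Γ) : BalancedTensor Γ X N →+ X :=
  lift (AddMonoidHom.mk' (fun x => AddMonoidHom.mk' (fun n => op (φ n) • x)
    fun a b => by rw [map_add, MulOpposite.op_add, add_smul]) fun a b => by ext n; exact smul_add _ _ _)
    fun x γ n => by
      change op (φ n) • op γ • x = op (φ (γ • n)) • x
      rw [map_smul, smul_eq_mul, op_mul, mul_smul]

lemma contract_map (φ : N →ₗ[Γ] Γ) (f : X →ₗ[Γᵐᵒᵖ] X') (t : BalancedTensor Γ X N) :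
    contract X' φ (map Γ f LinearMap.id t) = f (contract X φ t) := by
  have := hom_ext (f := (contract X' φ).comp (map Γ f LinearMap.id))
    (g := f.toAddMonoidHom.comp (contract X φ)) fun x n => (f.map_smul _ _).symm
  exact DFunLike.congr_fun this t

variable (Γ N) in
lemma exists_dual_basis [Module.Finite Γ N] [Module.Projective Γ N] :
    ∃ (k : ℕ) (e : Fin k → N) (φ : Fin k → (N →ₗ[Γ] Γ)), ∀ n, n = ∑ i, φ i n • e i := by
  obtain ⟨k, f, g, -, -, h⟩ := Module.Finite.exists_comp_eq_id_of_projective Γ N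
  refine ⟨k, fun i => f (Pi.single i 1), fun i => LinearMap.proj i ∘ₗ g, fun n => ?_⟩
  have h₁ : f (g n) = n := LinearMap.congr_fun h n
  conv_lhs => rw [← h₁, pi_eq_sum_univ' (g n), map_sum]
  simp

/-- A dual basis of `N` gives every tensor coordinates in `X`, natural in `X` by `contract_map`.
Exactness of tensoring with `N` is then checked coordinatewise, without flatness. -/
lemma eq_sum_contract {k : ℕ} {e : Fin k → N} {φ : Fin k → (N →ₗ[Γ] Γ)}
    (h : ∀ n, n = ∑ i, φ i n • e i) (t : BalancedTensor Γ X N) :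
    t = ∑ i, tmul Γ (contract X (φ i) t) (e i) := by
  induction t using induction_on with
  | zero => simp [zero_tmul]
  | tmul x n =>
    have : ∀ i, tmul Γ (contract X (φ i) (tmul Γ x n)) (e i) = tmul Γ x (φ i n • e i) :=
      fun i => smul_tmul Γ _ _ _
    simp_rw [this]
    conv_lhs => rw [h n]
    exact map_sum (AddMonoidHom.mk' (tmul Γ x) (tmul_add Γ x)) _ _
  | add a b ha hb =>
    simp_rw [map_add, add_tmul, Finset.sum_add_distrib]
    rw [← ha, ← hb]

lemma map_injective [Module.Finite Γ N] [Module.Projective Γ N] {f : X →ₗ[Γᵐᵒᵖ] X'}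
    (hf : Function.Injective f) : Function.Injective (map Γ f (LinearMap.id : N →ₗ[Γ] N)) := by
  obtain ⟨k, e, φ, h⟩ := exists_dual_basis Γ N
  rw [injective_iff_map_eq_zero]
  intro t ht
  rw [eq_sum_contract h t]
  refine Finset.sum_eq_zero fun i _ => ?_
  have : f (contract X (φ i) t) = 0 := by rw [← contract_map, ht, map_zero]
  rw [hf (this.trans (map_zero f).symm), zero_tmul]

lemma map_exact [Module.Finite Γ N] [Module.Projective Γ N] {f : X →ₗ[Γᵐᵒᵖ] X'}
    {g : X' →ₗ[Γᵐᵒᵖ] X''} (hfg : Function.Exact f g) :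
    Function.Exact (map Γ f (LinearMap.id : N →ₗ[Γ] N)) (map Γ g (LinearMap.id : N →ₗ[Γ] N)) := by
  obtain ⟨k, e, φ, h⟩ := exists_dual_basis Γ N
  intro t
  constructor
  · intro ht
    have h₁ : ∀ i, g (contract X' (φ i) t) = 0 := fun i => by rw [← contract_map, ht, map_zero]
    choose y hy using fun i => (hfg _).mp (h₁ i)
    refine ⟨∑ i, tmul Γ (y i) (e i), ?_⟩
    rw [map_sum]
    conv_rhs => rw [eq_sum_contract h t]
    simp [hy]
  · rintro ⟨s, rfl⟩
    induction s using induction_on with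
    | zero => simp
    | tmul x n => rw [map_tmul, map_tmul, hfg.apply_apply_eq_zero, zero_tmul]
    | add a b ha hb => rw [map_add, map_add, ha, hb, add_zero]

end

section Assoc

variable {Γ : Type u} [Ring Γ] {X M N : Type u} [AddCommGroup X] [Module Γᵐᵒᵖ X]
  [AddCommGroup M] [Module Γ M] [Module Γᵐᵒᵖ M] [SMulCommClass Γ Γᵐᵒᵖ M]
  [AddCommGroup N] [Module Γ N]

variable (M) in
/-- The right linear map `m ↦ x ⊗ m`. -/
def tmulLeft (x : X) : M →ₗ[Γᵐᵒᵖ] BalancedTensor Γ X M where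
  toFun m := tmul Γ x m
  map_add' := tmul_add Γ x
  map_smul' _ _ := rfl

variable (X M N) in
/-- The homomorphism `x ⊗ (m ⊗ n) ↦ (x ⊗ m) ⊗ n`. -/
def assocInv :
    BalancedTensor Γ X (BalancedTensor Γ M N) →+ BalancedTensor Γ (BalancedTensor Γ X M) N :=
  lift (AddMonoidHom.mk' (fun x => map Γ (tmulLeft M x) (LinearMap.id : N →ₗ[Γ] N)) fun a b =>
      hom_ext fun m n => by
        change tmul Γ (tmul Γ (a + b) m) n = tmul Γ (tmul Γ a m) n + tmul Γ (tmul Γ b m) n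
        rw [add_tmul, add_tmul])
    fun x γ t => by
      induction t using induction_on with
      | zero => simp
      | tmul m n => exact congrArg (fun s => tmul Γ s n) (smul_tmul Γ x γ m)
      | add a b ha hb => rw [smul_add, map_add, map_add, ha, hb]

/-- Surjectivity of the reassociation is enough to carry vanishing from the right-nested product to
the left-nested one. -/
lemma assocInv_surjective : Function.Surjective (assocInv (Γ := Γ) X M N) := by
  intro t
  induction t using induction_on with
  | zero => exact ⟨0, map_zero _⟩
  | tmul s n =>
    induction s using induction_on with
    | zero => exact ⟨0, by rw [zero_tmul, map_zero]⟩
    | tmul x m => exact ⟨tmul Γ x (tmul Γ m n), rfl⟩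
    | add a b ha hb =>
      obtain ⟨a', ha⟩ := ha
      obtain ⟨b', hb⟩ := hb
      exact ⟨a' + b', by rw [map_add, add_tmul, ha, hb]⟩
  | add a b ha hb =>
    obtain ⟨a', rfl⟩ := ha
    obtain ⟨b', rfl⟩ := hb
    exact ⟨a' + b', map_add _ _ _⟩

lemma subsingleton_right [Subsingleton N] : Subsingleton (BalancedTensor Γ X N) := by
  refine subsingleton_of_forall_eq 0 fun t => ?_
  induction t using induction_on with
  | zero => rfl
  | tmul x n => rw [Subsingleton.elim n 0, tmul_zero]
  | add a b ha hb => rw [ha, hb, add_zero]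

end Assoc

end BalancedTensor

/-! ### Finiteness and projectivity under restriction of scalars -/

section Restriction

variable {R S : Type u} [Ring R] [Ring S]

lemma module_finite_compHom (f : R →+* S)
    (hf : @Module.Finite R S _ _ (Module.compHom S f)) (X : Type u) [AddCommGroup X] [Module S X]
    [Module.Finite S X] : @Module.Finite R X _ _ (Module.compHom X f) := by
  let : Module R S := Module.compHom S f
  let : Module R X := Module.compHom X f
  have : IsScalarTower R S X := ⟨fun r s x => mul_smul (f r) s x⟩
  exact Module.Finite.trans S X

/-- An `S`-linear splitting of `X →₀ S` onto `X` is also `R`-linear, and `X →₀ S` is a direct sum of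
`R`-projective modules. -/
lemma module_projective_compHom (f : R →+* S)
    (hf : @Module.Projective R _ S _ (Module.compHom S f)) (X : Type u) [AddCommGroup X]
    [Module S X] [Module.Projective S X] : @Module.Projective R _ X _ (Module.compHom X f) := by
  let : Module R S := Module.compHom S f
  let : Module R X := Module.compHom X f
  have : IsScalarTower R S X := ⟨fun r s x => mul_smul (f r) s x⟩
  have : IsScalarTower R S S := ⟨fun r s x => mul_assoc (f r) s x⟩
  obtain ⟨s, hs⟩ := Module.projective_def'.mp (inferInstance : Module.Projective S X)
  have hp : Module.Projective R (X →₀ S) := by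
    classical
    exact Module.Projective.of_equiv (finsuppLequivDFinsupp (ι := X) (M := S) R).symm
  have h₁ (r : R) (y : X →₀ S) : r • y = f r • y := by
    ext x
    rfl
  let i : X →ₗ[R] (X →₀ S) :=
    { toFun := s, map_add' := s.map_add, map_smul' := fun r x => by
        rw [RingHom.id_apply, h₁]
        exact s.map_smul (f r) x }
  let p : (X →₀ S) →ₗ[R] X :=
    { toFun := Finsupp.linearCombination S id, map_add' := map_add _, map_smul' := fun r x => by
        rw [RingHom.id_apply, h₁]
        exact map_smul _ (f r) x }
  exact Module.Projective.of_split i p (LinearMap.ext fun x => LinearMap.congr_fun hs x)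

end Restriction

/-! ### Inflation, restriction and the filtration by powers of M -/

namespace ThetaExtension

variable {Γ : Type u} [Ring Γ] {M : Type u} [AddCommGroup M] [Module Γ M]
  [Module Γᵐᵒᵖ M] [SMulCommClass Γ Γᵐᵒᵖ M] (θ : AssocBimoduleHom Γ M)

/-- The projection `(γ, m) ↦ γ`. -/
def fstHom : ThetaExtension θ →+* Γ where
  toFun x := x.1
  map_one' := rfl
  map_zero' := rfl
  map_mul' _ _ := rfl
  map_add' _ _ := rfl

/-- The inclusion `m ↦ (0, m)`. -/
def inr : M →+ ThetaExtension θ where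
  toFun m := ((0, m) : Γ × M)
  map_zero' := rfl
  map_add' _ _ := ThetaExtension.ext (add_zero (0 : Γ)).symm rfl

@[simp] lemma fst_inl (γ : Γ) : (inl θ γ).1 = γ := rfl
@[simp] lemma snd_inl (γ : Γ) : (inl θ γ).2 = 0 := rfl
@[simp] lemma fst_inr (m : M) : (inr θ m).1 = 0 := rfl
@[simp] lemma snd_inr (m : M) : (inr θ m).2 = m := rfl

lemma eq_inl_add_inr (x : ThetaExtension θ) : x = inl θ x.1 + inr θ x.2 := by
  ext <;> simp

lemma inr_mul (m : M) (x : ThetaExtension θ) :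
    inr θ m * x = inr θ (op x.1 • m + θ.toHom (BalancedTensor.tmul Γ m x.2)) := by
  ext <;> simp

lemma inl_mul_inr (γ : Γ) (m : M) : inl θ γ * inr θ m = inr θ (γ • m) := by
  ext <;> simp [BalancedTensor.zero_tmul]

lemma inr_mul_inl (γ : Γ) (m : M) : inr θ m * inl θ γ = inr θ (op γ • m) := by
  ext <;> simp [BalancedTensor.tmul_zero]

lemma finite_fstHom : @Module.Finite (ThetaExtension θ)ᵐᵒᵖ Γᵐᵒᵖ _ _
    (Module.compHom Γᵐᵒᵖ (fstHom θ).op) := by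
  let : Module (ThetaExtension θ)ᵐᵒᵖ Γᵐᵒᵖ := Module.compHom Γᵐᵒᵖ (fstHom θ).op
  let e : (ThetaExtension θ)ᵐᵒᵖ →ₗ[(ThetaExtension θ)ᵐᵒᵖ] Γᵐᵒᵖ :=
    { toFun := (fstHom θ).op
      map_add' := map_add _
      map_smul' := map_mul (fstHom θ).op }
  exact Module.Finite.of_surjective e fun γ => ⟨op (inl θ γ.unop), rfl⟩

/-- As a right `Γ`-module, `Γ ⋉_θ M` is `Γ × M`. -/
def rightEquiv : letI := Module.compHom (ThetaExtension θ)ᵐᵒᵖ (inl θ).op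
    (Γᵐᵒᵖ × M) ≃ₗ[Γᵐᵒᵖ] (ThetaExtension θ)ᵐᵒᵖ :=
  letI := Module.compHom (ThetaExtension θ)ᵐᵒᵖ (inl θ).op
  { toFun := fun p => op ((p.1.unop, p.2) : Γ × M)
    invFun := fun x => (op x.unop.1, x.unop.2)
    left_inv := fun _ => rfl
    right_inv := fun _ => rfl
    map_add' := fun _ _ => rfl
    map_smul' := fun γ p => by
      apply unop_injective
      refine ThetaExtension.ext rfl ?_
      change γ • p.2 = p.1.unop • (0 : M) + op γ.unop • p.2 +
        θ.toHom (BalancedTensor.tmul Γ p.2 (0 : M))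
      simp [BalancedTensor.tmul_zero] }

lemma finite_inl [Module.Finite Γᵐᵒᵖ M] : @Module.Finite Γᵐᵒᵖ (ThetaExtension θ)ᵐᵒᵖ _ _
    (Module.compHom (ThetaExtension θ)ᵐᵒᵖ (inl θ).op) :=
  let := Module.compHom (ThetaExtension θ)ᵐᵒᵖ (inl θ).op
  Module.Finite.equiv (rightEquiv θ)

lemma projective_inl [Module.Projective Γᵐᵒᵖ M] :
    @Module.Projective Γᵐᵒᵖ _ (ThetaExtension θ)ᵐᵒᵖ _
      (Module.compHom (ThetaExtension θ)ᵐᵒᵖ (inl θ).op) :=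
  let := Module.compHom (ThetaExtension θ)ᵐᵒᵖ (inl θ).op
  Module.Projective.of_equiv (rightEquiv θ)

variable {θ}

/-- The right `Γ`-module underlying a right module over `Γ ⋉_θ M`. -/
noncomputable abbrev restrictedModule (X : FGRightMod (ThetaExtension θ)) : Module Γᵐᵒᵖ X :=
  Module.compHom X (inl θ).op

attribute [local instance] restrictedModule

/-- If `X ⊗_Γ M` maps onto `E X` for all `X`, then `M^{⊗ n} = 0` implies `Eⁿ = 0`. -/
lemma isZero_iterate (E : FGRightMod (ThetaExtension θ) → FGRightMod (ThetaExtension θ))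
    (hE : ∀ X : FGRightMod (ThetaExtension θ), ∃ g : BalancedTensor Γ X M →ₗ[Γᵐᵒᵖ] E X, Function.Surjective g) {n : ℕ}
    (hn : 0 < n) (hM : Subsingleton (BimodulePower Γ M n)) (X : FGRightMod (ThetaExtension θ)) :
    IsZero (E^[n] X) := by
  -- `E X ⊗ M^{⊗(j+1)}` is a quotient of `(X ⊗ M) ⊗ M^{⊗(j+1)}`, hence of `X ⊗ M^{⊗(j+2)}`. The
  -- induction starts at the first power because `M ⊗ M^{⊗j}` is by definition the next power only
  -- for `j ≥ 1`.
  have key (j : ℕ) (X : FGRightMod (ThetaExtension θ))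
      (h : Subsingleton (BalancedTensor Γ X (BimodulePower Γ M (j + 1)))) :
      IsZero (E^[j + 1] X) := by
    induction j generalizing X with
    | zero =>
      obtain ⟨g, hg⟩ := hE X
      exact (FGModuleCat.isZero_iff _).mpr (@Function.Surjective.subsingleton _ _ _ h hg)
    | succ j ih =>
      obtain ⟨g, hg⟩ := hE X
      refine ih (E X) ?_
      have h₁ : Subsingleton (BalancedTensor Γ (BalancedTensor Γ X M)
          (BimodulePower Γ M (j + 1))) :=
        @Function.Surjective.subsingleton _ _ _ h BalancedTensor.assocInv_surjective
      exact (BalancedTensor.map_surjective hg).subsingleton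
  obtain ⟨n, rfl⟩ := Nat.exists_eq_add_of_le' hn
  exact key n X BalancedTensor.subsingleton_right

/-- The action map `X ⊗_Γ M → X`. -/
noncomputable def act (X : FGRightMod (ThetaExtension θ)) : BalancedTensor Γ X M →+ X :=
  BalancedTensor.lift (AddMonoidHom.mk' (fun x => AddMonoidHom.mk' (fun m => op (inr θ m) • x)
      fun a b => by rw [map_add, MulOpposite.op_add, add_smul])
      fun a b => by ext m; exact smul_add _ _ _)
    fun x γ m => by
      change op (inr θ m) • op (inl θ γ) • x = op (inr θ (γ • m)) • x
      rw [← inl_mul_inr, op_mul, mul_smul]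

lemma act_tmul (X : FGRightMod (ThetaExtension θ)) (x : X) (m : M) :
    act X (BalancedTensor.tmul Γ x m) = op (inr θ m) • x := rfl

lemma act_smul (X : FGRightMod (ThetaExtension θ)) (γ : Γᵐᵒᵖ) (t : BalancedTensor Γ X M) :
    act X (γ • t) = γ • act X t := by
  induction t using BalancedTensor.induction_on with
  | zero => simp
  | tmul x m =>
    change op (inr θ (γ • m)) • x = op (inl θ γ.unop) • op (inr θ m) • x
    rw [← mul_smul, ← op_mul, inr_mul_inl, op_unop]
  | add a b ha hb => rw [smul_add, map_add, map_add, smul_add, ha, hb]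

/-- The submodule `X M` of `X`. -/
noncomputable def radSubmodule (X : FGRightMod (ThetaExtension θ)) :
    Submodule (ThetaExtension θ)ᵐᵒᵖ X where
  __ := (act X).range
  smul_mem' := by
    rintro l _ ⟨t, rfl⟩
    induction t using BalancedTensor.induction_on with
    | zero => exact ⟨0, by simp⟩
    | tmul x m =>
      -- Stability holds because `M` is a right ideal: the product of `inr θ m` with `l` is again
      -- `inr` of an element.
      refine ⟨BalancedTensor.tmul Γ x
        (op l.unop.1 • m + θ.toHom (BalancedTensor.tmul Γ m l.unop.2)), ?_⟩
      rw [act_tmul, act_tmul, ← inr_mul, op_mul, mul_smul, op_unop]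
    | add a b ha hb =>
      obtain ⟨a', ha⟩ := ha
      obtain ⟨b', hb⟩ := hb
      exact ⟨a' + b', by rw [map_add, map_add, smul_add, ha, hb]⟩

lemma smul_mem_radSubmodule (X : FGRightMod (ThetaExtension θ)) (m : M) (x : X) :
    op (inr θ m) • x ∈ radSubmodule X := ⟨BalancedTensor.tmul Γ x m, rfl⟩

lemma map_mem_radSubmodule {X Y : FGRightMod (ThetaExtension θ)}
    (f : X →ₗ[(ThetaExtension θ)ᵐᵒᵖ] Y) {x : X} (hx : x ∈ radSubmodule X) :
    f x ∈ radSubmodule Y := by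
  obtain ⟨t, rfl⟩ := hx
  induction t using BalancedTensor.induction_on with
  | zero => simp
  | tmul x m =>
    rw [act_tmul, map_smul]
    exact smul_mem_radSubmodule Y m _
  | add a b ha hb =>
    rw [map_add, map_add]
    exact add_mem ha hb

variable (θ) [IsNoetherianRing Γᵐᵒᵖ] [Module.Finite Γᵐᵒᵖ M]

/-- The functor `mod-Γ ⥤ mod-(Γ ⋉_θ M)` letting `M` act by zero. -/
noncomputable def inflation : FGRightMod Γ ⥤ FGRightMod (ThetaExtension θ) :=
  FGModuleCat.restrict (fstHom θ).op fun X => module_finite_compHom _ (finite_fstHom θ) X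

/-- The restriction functor `mod-(Γ ⋉_θ M) ⥤ mod-Γ`. -/
noncomputable def restriction : FGRightMod (ThetaExtension θ) ⥤ FGRightMod Γ :=
  FGModuleCat.restrict (inl θ).op fun X => module_finite_compHom _ (finite_inl θ) X

instance : (inflation θ).Additive := FGModuleCat.restrict_additive _ _
instance : PreservesFiniteLimits (inflation θ) :=
  FGModuleCat.restrict_preservesFiniteLimits _ _
instance : PreservesFiniteColimits (inflation θ) :=
  FGModuleCat.restrict_preservesFiniteColimits _ _
instance : (restriction θ).Additive := FGModuleCat.restrict_additive _ _
instance : PreservesFiniteLimits (restriction θ) :=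
  FGModuleCat.restrict_preservesFiniteLimits _ _
instance : PreservesFiniteColimits (restriction θ) :=
  FGModuleCat.restrict_preservesFiniteColimits _ _

/-- Inflation followed by restriction is the identity. -/
noncomputable def inflationCompRestriction : inflation θ ⋙ restriction θ ≅ 𝟭 (FGRightMod Γ) :=
  NatIso.ofComponents (fun X =>
    { hom := ObjectProperty.homMk (ModuleCat.ofHom
        (X := (restriction θ).obj ((inflation θ).obj X)) (Y := X)
        { toFun := id, map_add' := fun _ _ => rfl, map_smul' := fun _ _ => rfl })
      inv := ObjectProperty.homMk (ModuleCat.ofHom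
        (X := X) (Y := (restriction θ).obj ((inflation θ).obj X))
        { toFun := id, map_add' := fun _ _ => rfl, map_smul' := fun _ _ => rfl }) })
    fun _ => rfl

instance : (restriction θ).EssSurj where
  mem_essImage X := ⟨(inflation θ).obj X, ⟨(inflationCompRestriction θ).app X⟩⟩

lemma restriction_projective [Module.Projective Γᵐᵒᵖ M] (P : FGRightMod (ThetaExtension θ))
    (hP : Projective P) : Projective ((restriction θ).obj P) :=
  FGModuleCat.restrict_projective _ _
    (fun X _ => module_projective_compHom _ (projective_inl θ) X) P hP

/-- The functor `X ↦ X M`. -/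
noncomputable def rad : FGRightMod (ThetaExtension θ) ⥤ FGRightMod (ThetaExtension θ) where
  obj X := FGModuleCat.of _ (radSubmodule X)
  map f := FGModuleCat.ofHom (f.hom.hom.restrict fun _ => map_mem_radSubmodule f.hom.hom)
  map_id _ := rfl
  map_comp _ _ := rfl

/-- The functor `X ↦ X / X M`, with values in modules over `Γ ⋉_θ M`. -/
noncomputable def top : FGRightMod (ThetaExtension θ) ⥤ FGRightMod (ThetaExtension θ) where
  obj X := FGModuleCat.of _ (X ⧸ radSubmodule X)
  map f := FGModuleCat.ofHom ((radSubmodule _).mapQ (radSubmodule _) f.hom.hom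
    fun _ => map_mem_radSubmodule f.hom.hom)
  map_id X := by
    refine InducedCategory.hom_ext (ModuleCat.hom_ext ?_)
    exact Submodule.linearMap_qext (radSubmodule X) rfl
  map_comp {X _ _} _ _ := by
    refine InducedCategory.hom_ext (ModuleCat.hom_ext ?_)
    exact Submodule.linearMap_qext (radSubmodule X) rfl

instance : (rad θ).Additive where
  map_add := rfl

instance : (top θ).Additive where
  map_add {X Y f g} := by
    refine InducedCategory.hom_ext (ModuleCat.hom_ext ?_)
    exact Submodule.linearMap_qext (radSubmodule X) rfl

/-- The inclusion of `X M` in `X`. -/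
noncomputable def radι : rad θ ⟶ 𝟭 (FGRightMod (ThetaExtension θ)) where
  app X := FGModuleCat.ofHom (radSubmodule X).subtype
  naturality _ _ _ := rfl

/-- The projection from `X` to `X / X M`. -/
noncomputable def topπ :
    𝟭 (FGRightMod (ThetaExtension θ)) ⟶ (top θ ⋙ restriction θ) ⋙ inflation θ where
  app X := ObjectProperty.homMk <| ModuleCat.ofHom (X := X)
    (Y := (inflation θ).obj ((restriction θ).obj ((top θ).obj X)))
    { toFun := (radSubmodule X).mkQ
      map_add' := map_add _
      map_smul' := fun l x => by
        -- On `X / X M` an element `l` acts through its component in `Γ`, since the remaining part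
        -- `inr θ l.unop.2` sends `X` into `X M`.
        change (radSubmodule X).mkQ (l • x) = op (inl θ l.unop.1) • (radSubmodule X).mkQ x
        rw [← map_smul, ← sub_eq_zero, ← map_sub, ← sub_smul]
        refine (Submodule.Quotient.mk_eq_zero _).mpr ?_
        have : l - op (inl θ l.unop.1) = op (inr θ l.unop.2) := by
          rw [sub_eq_iff_eq_add']
          exact congrArg op (eq_inl_add_inr θ l.unop)
        rw [this]
        exact smul_mem_radSubmodule X _ _ }
  naturality _ _ _ := rfl

lemma radι_topπ (X : FGRightMod (ThetaExtension θ)) : (radι θ).app X ≫ (topπ θ).app X = 0 := by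
  ext x
  exact (Submodule.Quotient.mk_eq_zero _).mpr x.2

lemma shortExact_rad_top (X : FGRightMod (ThetaExtension θ)) :
    (ShortComplex.mk ((radι θ).app X) ((topπ θ).app X) (radι_topπ θ X)).ShortExact := by
  rw [FGModuleCat.shortExact_iff]
  refine ⟨Subtype.val_injective, fun x => ?_, Submodule.mkQ_surjective _⟩
  refine (Submodule.Quotient.mk_eq_zero (radSubmodule X)).trans ?_
  exact ⟨fun h => ⟨⟨x, h⟩, rfl⟩, fun ⟨y, h⟩ => h ▸ y.2⟩

lemma isZero_rad_iterate {n : ℕ} (hn : 0 < n) (hM : Subsingleton (BimodulePower Γ M n))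
    (X : FGRightMod (ThetaExtension θ)) : IsZero ((rad θ).obj^[n] X) := by
  refine isZero_iterate _ (fun X => ?_) hn hM X
  exact ⟨{ toFun := fun t => ⟨act X t, t, rfl⟩
           map_add' := fun a b => Subtype.ext (map_add _ _ _)
           map_smul' := fun γ t => Subtype.ext (act_smul X γ t) },
    fun ⟨_, t, h⟩ => ⟨t, Subtype.ext h⟩⟩

end ThetaExtension

/-! ### Base change and the kernel of the counit -/

namespace ThetaExtension

variable {Γ : Type u} [Ring Γ] {M : Type u} [AddCommGroup M] [Module Γ M]
  [Module Γᵐᵒᵖ M] [SMulCommClass Γ Γᵐᵒᵖ M] {θ : AssocBimoduleHom Γ M}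

attribute [local instance] restrictedModule

/-- The left `Γ`-module structure of `Γ ⋉_θ M`. -/
abbrev leftModule : Module Γ (ThetaExtension θ) := Module.compHom _ (inl θ)

attribute [local instance] leftModule

lemma smul_eq_inl_mul (γ : Γ) (l : ThetaExtension θ) : γ • l = inl θ γ * l := rfl

/-- As a left `Γ`-module, `Γ ⋉_θ M` is `Γ × M`. -/
def leftEquiv : (Γ × M) ≃ₗ[Γ] ThetaExtension θ where
  toFun p := p
  invFun l := l
  left_inv _ := rfl
  right_inv _ := rfl
  map_add' _ _ := rfl
  map_smul' γ p := by
    refine ThetaExtension.ext rfl ?_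
    change γ • p.2 = γ • p.2 + op p.1 • (0 : M) + θ.toHom (BalancedTensor.tmul Γ (0 : M) p.2)
    simp [BalancedTensor.zero_tmul]

instance finite_left [Module.Finite Γ M] : Module.Finite Γ (ThetaExtension θ) :=
  Module.Finite.equiv leftEquiv

instance projective_left [Module.Projective Γ M] : Module.Projective Γ (ThetaExtension θ) :=
  Module.Projective.of_equiv leftEquiv

/-- Right multiplication, as a homomorphism of left `Γ`-modules. -/
def rightMul (l : ThetaExtension θ) : ThetaExtension θ →ₗ[Γ] ThetaExtension θ where
  toFun x := x * l
  map_add' _ _ := add_mul _ _ _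
  map_smul' _ _ := mul_assoc _ _ _

section BaseChange

variable {A B : Type u} [AddCommGroup A] [Module Γᵐᵒᵖ A] [AddCommGroup B] [Module Γᵐᵒᵖ B]

/-- The right `Γ ⋉_θ M`-module structure of `A ⊗_Γ (Γ ⋉_θ M)`. -/
instance : Module (ThetaExtension θ)ᵐᵒᵖ (BalancedTensor Γ A (ThetaExtension θ)) where
  smul l := BalancedTensor.map Γ LinearMap.id (rightMul l.unop)
  one_smul t := by
    refine DFunLike.congr_fun (f := BalancedTensor.map Γ LinearMap.id (rightMul 1))
      (g := AddMonoidHom.id _) (BalancedTensor.hom_ext fun a l => ?_) t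
    exact congrArg (BalancedTensor.tmul Γ a) (mul_one l)
  mul_smul k l t := by
    refine DFunLike.congr_fun (f := BalancedTensor.map Γ LinearMap.id (rightMul (l.unop * k.unop)))
      (g := (BalancedTensor.map Γ LinearMap.id (rightMul k.unop)).comp
        (BalancedTensor.map Γ LinearMap.id (rightMul l.unop)))
      (BalancedTensor.hom_ext fun a x => ?_) t
    exact congrArg (BalancedTensor.tmul Γ a) (mul_assoc _ _ _).symm
  smul_zero l := map_zero (BalancedTensor.map Γ LinearMap.id (rightMul l.unop))
  smul_add l := map_add (BalancedTensor.map Γ LinearMap.id (rightMul l.unop))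
  add_smul k l t := by
    refine DFunLike.congr_fun (f := BalancedTensor.map Γ LinearMap.id (rightMul (k.unop + l.unop)))
      (g := BalancedTensor.map Γ LinearMap.id (rightMul k.unop) +
        BalancedTensor.map Γ LinearMap.id (rightMul l.unop))
      (BalancedTensor.hom_ext fun a x => ?_) t
    exact (congrArg (BalancedTensor.tmul Γ a) (mul_add _ _ _)).trans
      (BalancedTensor.tmul_add Γ _ _ _)
  zero_smul t := by
    refine DFunLike.congr_fun (f := BalancedTensor.map Γ LinearMap.id (rightMul 0))
      (g := 0) (BalancedTensor.hom_ext fun a x => ?_) t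
    exact (congrArg (BalancedTensor.tmul Γ a) (mul_zero _)).trans (BalancedTensor.tmul_zero Γ _)

lemma smul_tmul (k : (ThetaExtension θ)ᵐᵒᵖ) (a : A) (l : ThetaExtension θ) :
    k • BalancedTensor.tmul Γ a l = BalancedTensor.tmul Γ a (l * k.unop) := rfl

lemma tmul_eq_smul (a : A) (l : ThetaExtension θ) :
    BalancedTensor.tmul Γ a l = op l • BalancedTensor.tmul Γ a (1 : ThetaExtension θ) := by
  rw [smul_tmul, unop_op, one_mul]

lemma tmul_inl (a : A) (γ : Γ) :
    BalancedTensor.tmul Γ a (inl θ γ) = BalancedTensor.tmul Γ (op γ • a) (1 : ThetaExtension θ) := by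
  rw [BalancedTensor.smul_tmul, smul_eq_inl_mul, mul_one]

instance finite_baseChange [Module.Finite Γᵐᵒᵖ A] :
    Module.Finite (ThetaExtension θ)ᵐᵒᵖ (BalancedTensor Γ A (ThetaExtension θ)) := by
  classical
  obtain ⟨S, hS⟩ := (inferInstance : Module.Finite Γᵐᵒᵖ A).fg_top
  let i : A → BalancedTensor Γ A (ThetaExtension θ) := fun a => BalancedTensor.tmul Γ a 1
  refine ⟨⟨S.image i, top_unique fun t _ => ?_⟩⟩
  -- The elements `s ⊗ 1` with `s` in `S` generate, as scalars from `Γ` move across the tensor sign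
  -- and become multiplications by `inl`.
  have h (a : A) : i a ∈ Submodule.span (ThetaExtension θ)ᵐᵒᵖ (S.image i : Set _) := by
    have ha : a ∈ Submodule.span Γᵐᵒᵖ (S : Set A) := hS ▸ Submodule.mem_top
    induction ha using Submodule.span_induction with
    | mem x hx => exact Submodule.subset_span (Finset.mem_coe.mpr (Finset.mem_image_of_mem i hx))
    | zero => simp [i, BalancedTensor.zero_tmul]
    | add x y _ _ hx hy =>
      simp only [i, BalancedTensor.add_tmul] at *
      exact add_mem hx hy
    | smul γ x _ hx =>
      have : i (γ • x) = op (inl θ γ.unop) • i x := by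
        rw [← tmul_eq_smul, tmul_inl, op_unop]
      rw [this]
      exact Submodule.smul_mem _ _ hx
  induction t using BalancedTensor.induction_on with
  | zero => exact zero_mem _
  | tmul a l =>
    rw [tmul_eq_smul]
    exact Submodule.smul_mem _ _ (h a)
  | add a b ha hb => exact add_mem (ha trivial) (hb trivial)

/-- The map `f ⊗ 1`. -/
def baseChangeMap (f : A →ₗ[Γᵐᵒᵖ] B) : BalancedTensor Γ A (ThetaExtension θ)
    →ₗ[(ThetaExtension θ)ᵐᵒᵖ] BalancedTensor Γ B (ThetaExtension θ) where
  toFun := BalancedTensor.map Γ f LinearMap.id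
  map_add' := map_add _
  map_smul' k t := by
    refine DFunLike.congr_fun
      (f := (BalancedTensor.map Γ f (LinearMap.id : ThetaExtension θ →ₗ[Γ] _)).comp
        (BalancedTensor.map Γ LinearMap.id (rightMul k.unop)))
      (g := (BalancedTensor.map Γ LinearMap.id (rightMul k.unop)).comp
        (BalancedTensor.map Γ f LinearMap.id)) (BalancedTensor.hom_ext fun a x => ?_) t
    rfl

/-- The additive map `a ⊗ l ↦ h(a) l`. -/
noncomputable def extendAddHom {Y : FGRightMod (ThetaExtension θ)} (h : A →ₗ[Γᵐᵒᵖ] Y) :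
    BalancedTensor Γ A (ThetaExtension θ) →+ Y :=
  BalancedTensor.lift (AddMonoidHom.mk' (fun a => AddMonoidHom.mk'
      (fun l : ThetaExtension θ => op l • h a)
      fun k l => by rw [MulOpposite.op_add, add_smul])
      fun a b => by ext l; exact (congrArg (op l • ·) (map_add h a b)).trans (smul_add _ _ _))
    fun a γ l => by
      change op l • h (op γ • a) = op (inl θ γ * l) • h a
      rw [map_smul, op_mul, mul_smul]
      rfl

/-- The homomorphism `a ⊗ l ↦ h(a) l`. -/
noncomputable def extend {Y : FGRightMod (ThetaExtension θ)} (h : A →ₗ[Γᵐᵒᵖ] Y) :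
    BalancedTensor Γ A (ThetaExtension θ) →ₗ[(ThetaExtension θ)ᵐᵒᵖ] Y where
  toFun := extendAddHom h
  map_add' := map_add _
  map_smul' k t := by
    induction t using BalancedTensor.induction_on with
    | zero => simp
    | tmul a l => exact mul_smul k (op l) (h a)
    | add a b ha hb => rw [smul_add, map_add, map_add, smul_add, ha, hb]

lemma linearMap_ext {Y : Type*} [AddCommGroup Y] [Module (ThetaExtension θ)ᵐᵒᵖ Y]
    {f g : BalancedTensor Γ A (ThetaExtension θ) →ₗ[(ThetaExtension θ)ᵐᵒᵖ] Y}
    (h : ∀ a, f (BalancedTensor.tmul Γ a 1) = g (BalancedTensor.tmul Γ a 1)) : f = g := by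
  ext t
  refine DFunLike.congr_fun (f := f.toAddMonoidHom) (g := g.toAddMonoidHom)
    (BalancedTensor.hom_ext fun a l => ?_) t
  change f _ = g _
  rw [tmul_eq_smul, map_smul, map_smul, h]

end BaseChange

variable (θ) in
/-- The functor `– ⊗_Γ (Γ ⋉_θ M)`. -/
noncomputable def baseChange : FGRightMod Γ ⥤ FGRightMod (ThetaExtension θ) where
  obj A := FGModuleCat.of _ (BalancedTensor Γ A (ThetaExtension θ))
  map f := FGModuleCat.ofHom (baseChangeMap f.hom.hom)
  map_id _ := InducedCategory.hom_ext (ModuleCat.hom_ext (linearMap_ext fun _ => rfl))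
  map_comp _ _ := InducedCategory.hom_ext (ModuleCat.hom_ext (linearMap_ext fun _ => rfl))

instance : (baseChange θ).Additive where
  map_add := InducedCategory.hom_ext (ModuleCat.hom_ext (linearMap_ext fun _ =>
    BalancedTensor.add_tmul Γ _ _ _))

/-- Base change is left adjoint to restriction, and restriction preserves epimorphisms: the lifting
problem is solved over `Γ` on the elements `p ⊗ 1` and then extended. -/
lemma baseChange_projective [IsNoetherianRing Γᵐᵒᵖ] [Module.Finite Γᵐᵒᵖ M] (P : FGRightMod Γ)
    (hP : Projective P) : Projective ((baseChange θ).obj P) where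
  factors {E X} f e he := by
    have := FGModuleCat.module_projective_of_projective P
    let f₀ : BalancedTensor Γ P (ThetaExtension θ) →ₗ[(ThetaExtension θ)ᵐᵒᵖ] X := f.hom.hom
    let f' : P →ₗ[Γᵐᵒᵖ] X :=
      { toFun := fun p => f₀ (BalancedTensor.tmul Γ p (1 : ThetaExtension θ))
        map_add' := fun p q => by rw [BalancedTensor.add_tmul, map_add]
        map_smul' := fun γ p => by
          have : BalancedTensor.tmul Γ (γ • p) (1 : ThetaExtension θ) =
              op (inl θ γ.unop) • BalancedTensor.tmul Γ p (1 : ThetaExtension θ) := by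
            rw [← tmul_eq_smul, tmul_inl, op_unop]
          rw [this]
          exact f₀.map_smul _ _ }
    let e' : E →ₗ[Γᵐᵒᵖ] X :=
      { toFun := e.hom.hom
        map_add' := map_add _
        map_smul' := fun γ x => e.hom.hom.map_smul (op (inl θ γ.unop)) x }
    obtain ⟨h, hh⟩ := Module.projective_lifting_property e' f'
      ((FGModuleCat.epi_iff_surjective e).mp he)
    refine ⟨FGModuleCat.ofHom (extend h),
      InducedCategory.hom_ext (ModuleCat.hom_ext (linearMap_ext fun p => ?_))⟩
    change e.hom.hom (op (1 : ThetaExtension θ) • h p) = f' p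
    rw [op_one, one_smul]
    exact LinearMap.congr_fun hh p

section Exact

variable [IsNoetherianRing Γᵐᵒᵖ] [Module.Finite Γᵐᵒᵖ M] [Module.Finite Γ M]
  [Module.Projective Γ M]

/-- As a left `Γ`-module `Γ ⋉_θ M` is `Γ × M`, finitely generated and projective, so the dual basis
argument applies. -/
lemma baseChange_exact :
    PreservesFiniteLimits (baseChange θ) ∧ PreservesFiniteColimits (baseChange θ) := by
  refine FGModuleCat.preservesFiniteLimits_and_colimits _ fun T hT => ?_
  rw [FGModuleCat.shortExact_iff] at hT ⊢
  exact ⟨BalancedTensor.map_injective hT.1, BalancedTensor.map_exact hT.2.1,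
    BalancedTensor.map_surjective hT.2.2⟩

instance : PreservesFiniteLimits (baseChange θ) := baseChange_exact.1
instance : PreservesFiniteColimits (baseChange θ) := baseChange_exact.2

end Exact

/-- The counit `X ⊗_Γ (Γ ⋉_θ M) → X`. -/
noncomputable def counit (X : FGRightMod (ThetaExtension θ)) :
    BalancedTensor Γ X (ThetaExtension θ) →ₗ[(ThetaExtension θ)ᵐᵒᵖ] X :=
  extend LinearMap.id

lemma counit_tmul_one (X : FGRightMod (ThetaExtension θ)) (x : X) :
    counit X (BalancedTensor.tmul Γ x 1) = x := one_smul _ x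

/-- The map `X ⊗_Γ M → X ⊗_Γ (Γ ⋉_θ M)`, `x ⊗ m ↦ x ⊗ m - x m ⊗ 1`. -/
noncomputable def toKernelAux (X : FGRightMod (ThetaExtension θ)) :
    BalancedTensor Γ X M →+ BalancedTensor Γ X (ThetaExtension θ) :=
  BalancedTensor.lift (AddMonoidHom.mk' (fun x => AddMonoidHom.mk'
      (fun m => BalancedTensor.tmul Γ x (inr θ m) - BalancedTensor.tmul Γ (op (inr θ m) • x) 1)
      fun a b => by
        rw [map_add, MulOpposite.op_add, add_smul, BalancedTensor.tmul_add,
          BalancedTensor.add_tmul]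
        abel)
      fun a b => by
        ext m
        change BalancedTensor.tmul Γ (a + b) (inr θ m) -
          BalancedTensor.tmul Γ (op (inr θ m) • (a + b)) 1 =
          (BalancedTensor.tmul Γ a (inr θ m) - BalancedTensor.tmul Γ (op (inr θ m) • a) 1) +
          (BalancedTensor.tmul Γ b (inr θ m) - BalancedTensor.tmul Γ (op (inr θ m) • b) 1)
        rw [smul_add, BalancedTensor.add_tmul, BalancedTensor.add_tmul]
        abel)
    fun x γ m => by
      change BalancedTensor.tmul Γ (op γ • x) (inr θ m) -
          BalancedTensor.tmul Γ (op (inr θ m) • op (inl θ γ) • x) 1 =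
        BalancedTensor.tmul Γ x (inr θ (γ • m)) -
          BalancedTensor.tmul Γ (op (inr θ (γ • m)) • x) 1
      rw [BalancedTensor.smul_tmul, smul_eq_inl_mul, ← mul_smul, ← op_mul, inl_mul_inr]

lemma toKernelAux_tmul (X : FGRightMod (ThetaExtension θ)) (x : X) (m : M) :
    toKernelAux X (BalancedTensor.tmul Γ x m) =
      BalancedTensor.tmul Γ x (inr θ m) - BalancedTensor.tmul Γ (op (inr θ m) • x) 1 := rfl

lemma counit_toKernelAux (X : FGRightMod (ThetaExtension θ)) (t : BalancedTensor Γ X M) :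
    counit X (toKernelAux X t) = 0 := by
  induction t using BalancedTensor.induction_on with
  | zero => simp
  | tmul x m =>
    rw [toKernelAux_tmul, map_sub, counit_tmul_one]
    exact sub_self _
  | add a b ha hb => rw [map_add, map_add, ha, hb, add_zero]

lemma toKernelAux_smul (X : FGRightMod (ThetaExtension θ)) (γ : Γᵐᵒᵖ) (t : BalancedTensor Γ X M) :
    toKernelAux X (γ • t) = op (inl θ γ.unop) • toKernelAux X t := by
  induction t using BalancedTensor.induction_on with
  | zero => simp
  | tmul x m =>
    rw [BalancedTensor.smul_tmul_right, toKernelAux_tmul, toKernelAux_tmul, smul_sub, smul_tmul,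
      ← tmul_eq_smul, tmul_inl, unop_op, inr_mul_inl, op_unop]
    congr 2
    change _ = op (inl θ γ.unop) • op (inr θ m) • x
    rw [← mul_smul, ← op_mul, inr_mul_inl, op_unop]
  | add a b ha hb => rw [smul_add, map_add, map_add, smul_add, ha, hb]

/-- Modulo the image of `toKernelAux`, the element `x ⊗ inr m` equals `x m ⊗ 1`, so every tensor
reduces to its counit tensored with `1`. Hence that image is the whole kernel of the counit. -/
lemma exists_eq_toKernelAux_add (X : FGRightMod (ThetaExtension θ))
    (t : BalancedTensor Γ X (ThetaExtension θ)) :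
    ∃ s, t = toKernelAux X s + BalancedTensor.tmul Γ (counit X t) 1 := by
  induction t using BalancedTensor.induction_on with
  | zero => exact ⟨0, by simp [BalancedTensor.zero_tmul]⟩
  | tmul x l =>
    refine ⟨BalancedTensor.tmul Γ x l.2, ?_⟩
    have h : counit X (BalancedTensor.tmul Γ x l) = op l.1 • x + op (inr θ l.2) • x := by
      change op l • x = op (inl θ l.1) • x + op (inr θ l.2) • x
      rw [← add_smul, ← MulOpposite.op_add, ← eq_inl_add_inr]
    rw [h, toKernelAux_tmul, BalancedTensor.add_tmul, ← tmul_inl]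
    conv_lhs => rw [eq_inl_add_inr θ l, BalancedTensor.tmul_add]
    abel
  | add a b ha hb =>
    obtain ⟨s, hs⟩ := ha
    obtain ⟨s', hs'⟩ := hb
    refine ⟨s + s', ?_⟩
    rw [map_add, map_add, BalancedTensor.add_tmul]
    conv_lhs => rw [hs, hs']
    abel

variable [IsNoetherianRing Γᵐᵒᵖ] [Module.Finite Γᵐᵒᵖ M]

instance finite_restricted (X : FGRightMod (ThetaExtension θ)) : Module.Finite Γᵐᵒᵖ X :=
  module_finite_compHom _ (finite_inl θ) X

/-- The kernel of the counit. -/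
noncomputable def kernelCounit (X : FGRightMod (ThetaExtension θ)) : FGRightMod (ThetaExtension θ) :=
  FGModuleCat.of _ (LinearMap.ker (counit X))

lemma extOf_kernelCounit (X : FGRightMod (ThetaExtension θ)) :
    ExtOf (kernelCounit X) ((baseChange θ).obj ((restriction θ).obj X)) X :=
  FGModuleCat.extOf (X := kernelCounit X) (Y := (baseChange θ).obj ((restriction θ).obj X))
    (LinearMap.ker (counit X)).subtype (counit X) Subtype.val_injective
    (LinearMap.exact_subtype_ker_map _) fun x => ⟨_, counit_tmul_one X x⟩

lemma isZero_kernelCounit_iterate {n : ℕ} (hn : 0 < n) (hM : Subsingleton (BimodulePower Γ M n))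
    (X : FGRightMod (ThetaExtension θ)) : IsZero (kernelCounit^[n] X) := by
  refine isZero_iterate _ (fun X => ?_) hn hM X
  refine ⟨{ toFun := fun t => ⟨toKernelAux X t, counit_toKernelAux X t⟩
            map_add' := fun a b => Subtype.ext (map_add _ _ _)
            map_smul' := fun γ t => Subtype.ext (toKernelAux_smul X γ t) }, ?_⟩
  rintro ⟨t, ht⟩
  obtain ⟨s, hs⟩ := exists_eq_toKernelAux_add X t
  rw [LinearMap.mem_ker.mp ht, BalancedTensor.zero_tmul, add_zero] at hs
  exact ⟨s, Subtype.ext hs.symm⟩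

end ThetaExtension

/-! ### The bounds for the theta-extension -/

theorem mainTheorem6 (Γ : Type u) [Ring Γ] [IsNoetherianAlgebra Γ]
    (M : Type u) [AddCommGroup M] [Module Γ M] [Module Γᵐᵒᵖ M] [SMulCommClass Γ Γᵐᵒᵖ M]
    [Module.Finite Γ M] [Module.Finite Γᵐᵒᵖ M]
    (θ : AssocBimoduleHom Γ M)
    (n : ℕ) (hn : 0 < n) (hM : Subsingleton (BimodulePower Γ M n)) :
    (Module.Projective Γ M → Module.Projective Γᵐᵒᵖ M →
      ringIT Γ ≤ ringIT (ThetaExtension θ) ∧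
      ringIT (ThetaExtension θ) ≤ n * (ringIT Γ + 1) - 1) ∧
    (Module.Projective Γᵐᵒᵖ M →
      ringExtDim Γ ≤ ringExtDim (ThetaExtension θ) ∧
      ringExtDim (ThetaExtension θ) ≤ n * (ringExtDim Γ + 1) - 1) ∧
    (IsLeftPerfect Γ M →
      ringDerDim Γ ≤ ringDerDim (ThetaExtension θ) ∧
      ringDerDim (ThetaExtension θ) ≤ n * (ringDerDim Γ + 1) - 1) := by
  refine ⟨fun _ _ => ⟨?_, ?_⟩, fun _ => ⟨?_, ?_⟩, fun _ => ?_⟩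
  · exact igusaTodorovDistance_le_of_exact (ThetaExtension.restriction θ)
      (ThetaExtension.restriction_projective θ)
  · exact igusaTodorovDistance_le_of_filtration FGModuleCat.addObj_of_projective
      (ThetaExtension.baseChange θ) ThetaExtension.baseChange_projective
      ThetaExtension.kernelCounit (ThetaExtension.restriction θ).obj
      ThetaExtension.extOf_kernelCounit hn (ThetaExtension.isZero_kernelCounit_iterate hn hM)
  · exact extensionDimension_le_of_exact (ThetaExtension.restriction θ)
  · exact extensionDimension_le_of_filtration (ThetaExtension.inflation θ)
      (ThetaExtension.rad θ).obj (ThetaExtension.top θ ⋙ ThetaExtension.restriction θ).obj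
      (fun X => ⟨_, _, _, ThetaExtension.shortExact_rad_top θ X⟩) hn
      (ThetaExtension.isZero_rad_iterate θ hn hM)
  -- These are the derived categories chosen in `ringDerDim`.
  · let := HasDerivedCategory.standard (FGRightMod Γ)
    let := HasDerivedCategory.standard (FGRightMod (ThetaExtension θ))
    exact ⟨rouquierDimension_le_of_exact (ThetaExtension.restriction θ)
      (ThetaExtension.inflation θ) (ThetaExtension.inflationCompRestriction θ),
      rouquierDimension_le_of_filtration (ThetaExtension.inflation θ) (ThetaExtension.rad θ)
        (ThetaExtension.top θ ⋙ ThetaExtension.restriction θ) (ThetaExtension.radι θ)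
        (ThetaExtension.topπ θ) (ThetaExtension.radι_topπ θ)
        (ThetaExtension.shortExact_rad_top θ) hn (ThetaExtension.isZero_rad_iterate θ hn hM)⟩
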